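/- Let $\mathcal G$ be a finite group, let $g\mapsto U_g$ be a unitary representation, or more generally a unitary projective representation ($U_e=\mathbb 1$, $U_gU_h=w(g,h)U_{gh}$), of $\mathcal G$ on a finite-dimensional complex Hilbert space $\mathcal H$, let $|\psi\rangle\in\mathcal H$ be a unit vector, and consider the ensemble of equiprobable states $|\psi_g\rangle=U_g|\psi\rangle$, $g\in\mathcal G$, with ensemble operator $\Omega=\frac1{|\mathcal G|}\sum_g|\psi_g\rangle\langle\psi_g|$. A measurement is a family $\{\Pi_g\}_{g\in\mathcal G}$ of positive semidefinite operators with $\sum_g\Pi_g\le\mathbb 1$ which is complete on the ensemble, $\sum_g\Pi_g|\psi_h\rangle=|\psi_h\rangle$ for all $h$ (for example $\sum_g\Pi_g=\mathbb 1$, or $\sum_g\Pi_g$ equal to the projector onto $\mathrm{span}\{|\psi_g\rangle\}$); its exclusion error probability is $P_e=\frac1{|\mathcal G|}\sum_g\langle\psi_g|\Pi_g|\psi_g\rangle$. Assume that perfect exclusion is impossible, that is, no measurement has $P_e=0$. Then there are decompositions $U_g=\bigoplus_\mu U^\mu_g\otimes\mathbb 1_{m_\mu}$ into pairwise inequivalent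 unitary irreps $U^\mu$ (with the same multiplier $w$) of dimensions $d_\mu$, with orthonormal (Schmidt) bases $\{|v^\mu_k\rangle\}_{k=1}^{d_\mu}$ of the irreps and $\{|u^\mu_k\rangle\}_{k=1}^{m_\mu}$ of the multiplicity spaces, ranks $r_\mu\le\min(d_\mu,m_\mu)$ and numbers $\alpha^\mu_k>0$, such that $$|\psi\rangle=\sum_\mu\sqrt{\tfrac{d_\mu}{|\mathcal G|}}\sum_{k=1}^{r_\mu}\sqrt{\alpha_k^\mu}\,|\xi^\mu_k\rangle,\qquad |\xi^\mu_k\rangle=|v^\mu_k\rangle|u^\mu_k\rangle .$$ For every such decomposition, the largest eigenvalue of $\Omega$ belongs to exactly one irrep (i.e. has an eigenvector in exactly one isotypic component); label it $\mu=1$. It satisfies $d_1=r_1=1$. With $\beta^\mu_k=\sqrt{\alpha^\mu_k/|\mathcal G|}$, the seed $$|\omega\rangle=\frac1{\sqrt{|\mathcal G|}}\Big(|\xi^1_1\rangle-\sum_{\mu\ne1}\sqrt{d_\mu}\sum_{k=1}^{r_\mu}|\xi^\mu_k\rangle\Big)$$ satisfies $\sqrt{|\mathcal G|}\,\langle\psi|\omega\rangle=\zeta:=\beta^1_1-\sum_{\mu\ne1}\sum_{k=1}^{r_\mu}d_\mu\beta^\mu_k>0$.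 The operators $U_g|\omega\rangle\langle\omega|U_g^\dagger$ sum to the projector onto $\mathrm{span}\{|\psi_g\rangle\}$ and form a measurement which minimizes $P_e$ among all measurements, with minimum value $\zeta^2/|\mathcal G|$. Moreover, with $Y=\frac1{|\mathcal G|}\sum_gU_g|\omega\rangle\langle\omega|\psi\rangle\langle\psi|U_g^\dagger$, the operator $|\psi\rangle\langle\psi|-|\mathcal G|Y$ and all the operators $\frac1{|\mathcal G|}|\psi_g\rangle\langle\psi_g|-Y$, $g\in\mathcal G$, are positive semidefinite. -/

import Mathlib

open scoped InnerProductSpace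

namespace QSE

noncomputable section

/-- The operator `|x⟩⟨y|`. -/
def ketbra {H : Type*} [NormedAddCommGroup H] [InnerProductSpace ℂ H] (x y : H) : H →ₗ[ℂ] H :=
  (InnerProductSpace.rankOne ℂ x y : H →L[ℂ] H)

/-- Conjugation `V A V†` of an operator by a unitary. -/
def conj {H : Type*} [NormedAddCommGroup H] [InnerProductSpace ℂ H]
    (V : H ≃ₗᵢ[ℂ] H) (A : H →ₗ[ℂ] H) : H →ₗ[ℂ] H :=
  V.toLinearEquiv.toLinearMap ∘ₗ A ∘ₗ V.symm.toLinearEquiv.toLinearMap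

/-- `U` is a unitary projective representation with multiplier `w`; the case `w = 1` is that of
ordinary (linear) unitary representations. -/
structure IsProjectiveRep {𝒢 : Type*} [Group 𝒢] {H : Type*} [NormedAddCommGroup H]
    [InnerProductSpace ℂ H] (w : 𝒢 → 𝒢 → ℂ) (U : 𝒢 → H ≃ₗᵢ[ℂ] H) : Prop where
  map_one : ∀ x, U 1 x = x
  map_mul : ∀ g h x, U g (U h x) = w g h • U (g * h) x

/-- `D` is a `d`-dimensional irreducible unitary projective matrix representation with
multiplier `w`. -/
structure IsMatrixIrrep {𝒢 : Type*} [Group 𝒢] (w : 𝒢 → 𝒢 → ℂ) {d : ℕ}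
    (D : 𝒢 → Matrix (Fin d) (Fin d) ℂ) : Prop where
  dim_pos : 0 < d
  unitary : ∀ g, D g ∈ Matrix.unitaryGroup (Fin d) ℂ
  map_one : D 1 = 1
  map_mul : ∀ g h, D g * D h = w g h • D (g * h)
  irreducible : ∀ W : Submodule ℂ (Fin d → ℂ),
    (∀ g, ∀ x ∈ W, Matrix.mulVec (D g) x ∈ W) → W = ⊥ ∨ W = ⊤

/-- Two matrix representations (with the same multiplier) are isomorphic. -/
def IsIsomorphic {𝒢 : Type*} {d d' : ℕ} (D : 𝒢 → Matrix (Fin d) (Fin d) ℂ)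
    (D' : 𝒢 → Matrix (Fin d') (Fin d') ℂ) : Prop :=
  ∃ T : (Fin d → ℂ) ≃ₗ[ℂ] (Fin d' → ℂ),
    ∀ g x, T (Matrix.mulVec (D g) x) = Matrix.mulVec (D' g) (T x)

section Exclusion

variable {ι : Type*} [Fintype ι] {H : Type*} [NormedAddCommGroup H] [InnerProductSpace ℂ H]

/-- A measurement for the pure states `φ k`, with one outcome for each label `k`: positive
semidefinite operators with sum at most the identity, and such that on the states of the ensemble
the outcomes have total probability one (so that there is no inconclusive outcome). For
`0 ≤ S ≤ 1`, `⟨φ k, S φ k⟩ = 1` is the same as `S (φ k) = φ k`. Both `∑ k, Π k = 1` and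
`∑ k, Π k = ` the projector onto the span of the ensemble are allowed. -/
structure IsMeasurement (φ : ι → H) (Q : ι → H →ₗ[ℂ] H) : Prop where
  pos : ∀ k, (Q k).IsPositive
  le_one : (1 - ∑ k, Q k : H →ₗ[ℂ] H).IsPositive
  complete : ∀ j, (∑ k, Q k) (φ j) = φ j

/-- The average error probability of exclusion for equiprobable states: outcome `k` announces
"the state was not `φ k`". -/
def errorProb (φ : ι → H) (Q : ι → H →ₗ[ℂ] H) : ℝ :=
  (1 / (Fintype.card ι : ℝ)) * ∑ k, (⟪φ k, Q k (φ k)⟫_ℂ).re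

/-- Perfect (zero-error, always conclusive) exclusion is possible. -/
def PerfectExclusion (φ : ι → H) : Prop :=
  ∃ Q : ι → H →ₗ[ℂ] H, IsMeasurement φ Q ∧ errorProb φ Q = 0

/-- `Q` is optimal for minimum-error exclusion of the equiprobable states `φ k`. -/
def IsMinimumError (φ : ι → H) (Q : ι → H →ₗ[ℂ] H) : Prop :=
  IsMeasurement φ Q ∧ ∀ Q', IsMeasurement φ Q' → errorProb φ Q ≤ errorProb φ Q'

/-- The ensemble operator `Ω` of the equiprobable states `φ k`. -/
def ensembleOp (φ : ι → H) : H →ₗ[ℂ] H :=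
  (1 / (Fintype.card ι : ℂ)) • ∑ k, ketbra (φ k) (φ k)

end Exclusion

section Group

variable {𝒢 : Type*} [Group 𝒢] [Fintype 𝒢] {H : Type*} [NormedAddCommGroup H]
  [InnerProductSpace ℂ H]

/-- The ensemble `ψ_g = U_g ψ`. -/
def orbit (U : 𝒢 → H ≃ₗᵢ[ℂ] H) (ψ : H) (g : 𝒢) : H := U g ψ

/-- The covariant measurement `U_g |ω⟩⟨ω| U_g†` generated by a seed `ω`. -/
def covariant (U : 𝒢 → H ≃ₗᵢ[ℂ] H) (ω : H) (g : 𝒢) : H →ₗ[ℂ] H :=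
  conj (U g) (ketbra ω ω)

/-- `Y = (1/|𝒢|) ∑_g U_g |ω⟩⟨ω|ψ⟩⟨ψ| U_g†`. -/
def dualOp (U : 𝒢 → H ≃ₗᵢ[ℂ] H) (ψ ω : H) : H →ₗ[ℂ] H :=
  (1 / (Fintype.card 𝒢 : ℂ)) • ∑ g, conj (U g) (ketbra ω ω ∘ₗ ketbra ψ ψ)

/-- A decomposition `U_g = ⨁_μ U_g^μ ⊗ 1_{m_μ}` of the representation into pairwise inequivalent
irreps of dimensions `d μ` with multiplicities `m μ`, in orthonormal bases `v_i^μ`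
(`i < d μ`) of the irreps and `u_a^μ` (`a < m μ`) of the multiplicity spaces which are Schmidt
bases for the components of the seed `ψ`. The vector `basis ⟨μ, i, a⟩` is `v_i^μ ⊗ u_a^μ`. -/
structure SchmidtDecomposition (w : 𝒢 → 𝒢 → ℂ) (U : 𝒢 → H ≃ₗᵢ[ℂ] H) (ψ : H) where
  /-- number of irreps -/
  n : ℕ
  /-- dimensions of the irreps -/
  d : Fin n → ℕ
  /-- multiplicities of the irreps -/
  m : Fin n → ℕ
  /-- matrices of the irreps in the bases `v^μ` -/
  irrep : ∀ μ, 𝒢 → Matrix (Fin (d μ)) (Fin (d μ)) ℂ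
  irrep_isIrrep : ∀ μ, IsMatrixIrrep w (irrep μ)
  inequivalent : ∀ μ ν, μ ≠ ν → ¬ IsIsomorphic (irrep μ) (irrep ν)
  /-- the product basis `v_i^μ ⊗ u_a^μ` -/
  basis : OrthonormalBasis (Σ μ : Fin n, Fin (d μ) × Fin (m μ)) ℂ H
  equivariant : ∀ g μ i a,
    U g (basis ⟨μ, i, a⟩) = ∑ j, irrep μ g j i • basis ⟨μ, j, a⟩
  /-- Schmidt ranks -/
  r : Fin n → ℕ
  r_le_d : ∀ μ, r μ ≤ d μ
  r_le_m : ∀ μ, r μ ≤ m μ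
  /-- squared Schmidt coefficients -/
  α : ∀ μ, Fin (r μ) → ℝ
  α_pos : ∀ μ k, 0 < α μ k
  /-- `ψ = ∑_μ √(d_μ/|𝒢|) ∑_k √(α_k^μ) v_k^μ ⊗ u_k^μ` -/
  seed_eq : ψ = ∑ μ, ∑ k : Fin (r μ),
    ((√((d μ : ℝ) / Fintype.card 𝒢) * √(α μ k) : ℝ) : ℂ) •
      basis ⟨μ, Fin.castLE (r_le_d μ) k, Fin.castLE (r_le_m μ) k⟩

namespace SchmidtDecomposition

variable {w : 𝒢 → 𝒢 → ℂ} {U : 𝒢 → H ≃ₗᵢ[ℂ] H} {ψ : H} (D : SchmidtDecomposition w U ψ)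

/-- `ξ_k^μ = v_k^μ ⊗ u_k^μ`. -/
def ξ (μ : Fin D.n) (k : Fin (D.r μ)) : H :=
  D.basis ⟨μ, Fin.castLE (D.r_le_d μ) k, Fin.castLE (D.r_le_m μ) k⟩

/-- `β_k^μ = √(α_k^μ/|𝒢|)`. -/
def β (μ : Fin D.n) (k : Fin (D.r μ)) : ℝ := √(D.α μ k / Fintype.card 𝒢)

/-- The isotypic component of `μ`. -/
def isotypic (μ : Fin D.n) : Submodule ℂ H :=
  Submodule.span ℂ (Set.range fun p : Fin (D.d μ) × Fin (D.m μ) => D.basis ⟨μ, p⟩)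

/-- The largest eigenvalue of the ensemble operator belongs to the irrep `μ`, i.e. it has an
eigenvector in the isotypic component of `μ`. -/
def HasLargestEigenvalue (μ : Fin D.n) : Prop :=
  ∃ lam : ℝ,
    (∀ κ : ℝ, Module.End.HasEigenvalue (ensembleOp (orbit U ψ)) (κ : ℂ) → κ ≤ lam) ∧
    ∃ x ∈ D.isotypic μ, x ≠ 0 ∧ ensembleOp (orbit U ψ) x = (lam : ℂ) • x

/-- The seed of the minimum-error measurement, `μ₁` being the irrep of the largest eigenvalue:
`ω = (1/√|𝒢|) (√d_{μ₁} ∑_k ξ_k^{μ₁} - ∑_{μ ≠ μ₁} √d_μ ∑_k ξ_k^μ)`. For a one-dimensional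
irrep `μ₁` the first sum has a single term. -/
def optimalSeed (μ₁ : Fin D.n) : H :=
  ((1 / √(Fintype.card 𝒢 : ℝ) : ℝ) : ℂ) •
    (∑ k, ((√(D.d μ₁ : ℝ) : ℝ) : ℂ) • D.ξ μ₁ k -
      ∑ μ ∈ Finset.univ.erase μ₁, ∑ k, ((√(D.d μ : ℝ) : ℝ) : ℂ) • D.ξ μ k)

/-- `ζ = ∑_k d_{μ₁} β_k^{μ₁} - ∑_{μ ≠ μ₁} ∑_k d_μ β_k^μ`; for a one-dimensional irrep `μ₁` the
first sum is just the single coefficient `β_1^{μ₁}`. -/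
def ζ (μ₁ : Fin D.n) : ℝ :=
  ∑ k, (D.d μ₁ : ℝ) * D.β μ₁ k - ∑ μ ∈ Finset.univ.erase μ₁, ∑ k, (D.d μ : ℝ) * D.β μ k

end SchmidtDecomposition

end Group

end

end QSE

/-! Every operator involved is a group average of rank-one operators. By Schur orthogonality, the
average of `ketbra (U g x) (U g y)` is of the form ∑ f_{μ,k} 1 ⊗ |u_k⟩⟨u_k| as soon as the
coordinate matrices of x and y have products diagonal in the Schmidt index (`sum_ketbra_combo`).
Hence Ω has eigenvalues (β_k^μ)² on the span of the ensemble, and a seed whose coordinate matrices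
are √(d_μ/|𝒢|) times the first r_μ columns of unitaries W^μ generates a measurement.

For such a seed √|𝒢| ⟨ψ|ω⟩ = ∑ d_μ β_k^μ W^μ_{kk}. A unitary can have constant diagonal equal to the
mean of d_μ prescribed phases, so the overlap becomes a sum of phases times side lengths: d_μ sides
of length ∑_k β_k^μ for each μ. It can be made zero when no side exceeds the sum of the others, by
closing a polygon (`perfectExclusion_of_polygon`). If perfect exclusion is impossible, some side is
longer than all the others together. Such a side cannot be repeated, so d = 1 and r = 1 for its
irrep, and the excess length is ζ > 0. In particular its β exceeds every other one, which identifies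
the largest eigenvalue.

Optimality is weak duality: an operator Y on the span of the ensemble lying below every weighted
state bounds the error by its trace (`re_trace_le_errorProb`). `dualOp` has trace ζ²/|𝒢|, the error
of the proposed measurement. By covariance its feasibility reduces to |𝒢| Y ≤ |ψ⟩⟨ψ|, which is
Cauchy–Schwarz (`sum_sgn_le`, `weighted_square_le`).

The Schmidt decomposition exists by complete reducibility followed by a singular value decomposition
in each isotypic component. -/

open scoped InnerProductSpace

namespace QSE

noncomputable section

/-! ### Schur's lemma and orthogonality of matrix elements with a multiplier. -/

section Schur

variable {𝒢 : Type*} {w : 𝒢 → 𝒢 → ℂ}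

theorem IsIsomorphic.refl {d : ℕ} (D : 𝒢 → Matrix (Fin d) (Fin d) ℂ) : IsIsomorphic D D :=
  ⟨LinearEquiv.refl _ _, fun _ _ => rfl⟩

theorem IsIsomorphic.symm {d d' : ℕ} {D : 𝒢 → Matrix (Fin d) (Fin d) ℂ}
    {D' : 𝒢 → Matrix (Fin d') (Fin d') ℂ} (h : IsIsomorphic D D') : IsIsomorphic D' D := by
  obtain ⟨T, hT⟩ := h
  refine ⟨T.symm, fun g x => ?_⟩
  rw [LinearEquiv.symm_apply_eq, hT, LinearEquiv.apply_symm_apply]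

theorem IsIsomorphic.trans {d d' d'' : ℕ} {D : 𝒢 → Matrix (Fin d) (Fin d) ℂ}
    {D' : 𝒢 → Matrix (Fin d') (Fin d') ℂ} {D'' : 𝒢 → Matrix (Fin d'') (Fin d'') ℂ}
    (h : IsIsomorphic D D') (h' : IsIsomorphic D' D'') : IsIsomorphic D D'' := by
  obtain ⟨T, hT⟩ := h
  obtain ⟨S, hS⟩ := h'
  exact ⟨T.trans S, fun g x => by simp [hT, hS]⟩

variable [Group 𝒢]

/-- Schur's lemma: an intertwiner between irreps is zero or an isomorphism. -/
theorem IsMatrixIrrep.intertwiner_eq_zero {d d' : ℕ} {D : 𝒢 → Matrix (Fin d) (Fin d) ℂ}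
    {D' : 𝒢 → Matrix (Fin d') (Fin d') ℂ} (hD : IsMatrixIrrep w D) (hD' : IsMatrixIrrep w D')
    (hne : ¬ IsIsomorphic D' D) (A : Matrix (Fin d) (Fin d') ℂ)
    (hA : ∀ g, D g * A = A * D' g) : A = 0 := by
  have hcomm : ∀ g x, A.mulVec ((D' g).mulVec x) = (D g).mulVec (A.mulVec x) := by
    intro g x
    rw [Matrix.mulVec_mulVec, Matrix.mulVec_mulVec, hA]
  rcases hD'.irreducible (LinearMap.ker A.mulVecLin) (by
      intro g x hx
      simp only [LinearMap.mem_ker, Matrix.mulVecLin_apply] at hx ⊢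
      rw [hcomm, hx, Matrix.mulVec_zero]) with hk | hk
  · rcases hD.irreducible (LinearMap.range A.mulVecLin) (by
        rintro g _ ⟨x, rfl⟩
        exact ⟨(D' g).mulVec x, by simpa using hcomm g x⟩) with hr | hr
    · rw [LinearMap.range_eq_bot] at hr
      exact Matrix.toLin'.injective (by rw [map_zero]; exact hr)
    · exact absurd ⟨LinearEquiv.ofBijective A.mulVecLin
        ⟨LinearMap.ker_eq_bot.1 hk, LinearMap.range_eq_top.1 hr⟩, fun g x => hcomm g x⟩ hne
  · rw [LinearMap.ker_eq_top] at hk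
    exact Matrix.toLin'.injective (by rw [map_zero]; exact hk)

/-- Schur's lemma: a self-intertwiner of an irrep is a scalar. -/
theorem IsMatrixIrrep.intertwiner_eq_smul_one {d : ℕ} {D : 𝒢 → Matrix (Fin d) (Fin d) ℂ}
    (hD : IsMatrixIrrep w D) (A : Matrix (Fin d) (Fin d) ℂ)
    (hA : ∀ g, D g * A = A * D g) : ∃ c : ℂ, A = c • 1 := by
  have : Nonempty (Fin d) := ⟨⟨0, hD.dim_pos⟩⟩
  obtain ⟨c, hc⟩ := Module.End.exists_eigenvalue A.mulVecLin
  refine ⟨c, ?_⟩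
  have hinv := hD.irreducible (Module.End.eigenspace A.mulVecLin c) (by
    intro g x hx
    rw [Module.End.mem_eigenspace_iff, Matrix.mulVecLin_apply] at hx ⊢
    rw [Matrix.mulVec_mulVec, ← hA, ← Matrix.mulVec_mulVec, hx, Matrix.mulVec_smul])
  rcases hinv with h | h
  · exact absurd h hc
  · apply Matrix.toLin'.injective
    ext1 x
    ext1
    have hx := Module.End.mem_eigenspace_iff.1
      (h ▸ Submodule.mem_top : Pi.single x 1 ∈ Module.End.eigenspace A.mulVecLin c)
    simp only [Matrix.mulVecLin_apply] at hx
    simp [hx]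

/-- The multiplier is a phase because it relates two unitary matrices of positive size; this is what
makes the factors `w` cancel in group averages. -/
theorem IsMatrixIrrep.norm_multiplier {d : ℕ} {D : 𝒢 → Matrix (Fin d) (Fin d) ℂ}
    (hD : IsMatrixIrrep w D) (g h : 𝒢) : w g h * star (w g h) = 1 := by
  have : Nonempty (Fin d) := ⟨⟨0, hD.dim_pos⟩⟩
  have h1 := Matrix.mem_unitaryGroup_iff.1 (mul_mem (hD.unitary g) (hD.unitary h))
  have h2 := Matrix.mem_unitaryGroup_iff.1 (hD.unitary (g * h))
  rw [hD.map_mul, star_smul, smul_mul_smul_comm, h2] at h1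
  obtain ⟨i⟩ := this
  simpa using congrFun (congrFun h1 i) i

open Matrix in
/-- The group average of `A` intertwines the two representations. -/
theorem IsMatrixIrrep.sum_intertwines [Fintype 𝒢] {d d' : ℕ}
    {D : 𝒢 → Matrix (Fin d) (Fin d) ℂ}
    {D' : 𝒢 → Matrix (Fin d') (Fin d') ℂ} (hD : IsMatrixIrrep w D) (hD' : IsMatrixIrrep w D')
    (A : Matrix (Fin d) (Fin d') ℂ) (h : 𝒢) :
    D h * (∑ g, D g * A * (D' g)ᴴ) = (∑ g, D g * A * (D' g)ᴴ) * D' h := by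
  have key : D h * (∑ g, D g * A * (D' g)ᴴ) * (D' h)ᴴ = ∑ g, D g * A * (D' g)ᴴ := by
    rw [Matrix.mul_sum, Matrix.sum_mul,
      ← Equiv.sum_comp (Equiv.mulLeft h) (fun g => D g * A * (D' g)ᴴ)]
    refine Finset.sum_congr rfl fun g _ => ?_
    have e1 : D h * (D g * A * (D' g)ᴴ) * (D' h)ᴴ = (D h * D g) * A * (D' h * D' g)ᴴ := by
      rw [Matrix.conjTranspose_mul]
      simp only [Matrix.mul_assoc]
    rw [e1, hD.map_mul, hD'.map_mul, Matrix.conjTranspose_smul]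
    simp only [Matrix.smul_mul, Matrix.mul_smul, smul_smul, Equiv.coe_mulLeft]
    rw [mul_comm, hD.norm_multiplier, one_smul]
  have hu : (D' h)ᴴ * D' h = 1 := Matrix.mem_unitaryGroup_iff'.1 (hD'.unitary h)
  calc _ = D h * (∑ g, D g * A * (D' g)ᴴ) * ((D' h)ᴴ * D' h) := by rw [hu, Matrix.mul_one]
    _ = _ := by rw [← Matrix.mul_assoc, key]

open Matrix in
theorem mul_single_mul_conjTranspose_apply {d d' : ℕ} (B : Matrix (Fin d) (Fin d) ℂ)
    (C : Matrix (Fin d') (Fin d') ℂ) (i j : Fin d) (k l : Fin d') :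
    (B * Matrix.single j l (1 : ℂ) * Cᴴ) i k = B i j * star (C k l) := by
  simp [Matrix.mul_apply, Matrix.single_apply, Finset.sum_ite_eq, ite_and]

open Matrix in
/-- Orthogonality relations for matrix elements of inequivalent irreps. -/
theorem IsMatrixIrrep.orthogonality_of_not_isIsomorphic [Fintype 𝒢] {d d' : ℕ}
    {D : 𝒢 → Matrix (Fin d) (Fin d) ℂ} {D' : 𝒢 → Matrix (Fin d') (Fin d') ℂ}
    (hD : IsMatrixIrrep w D) (hD' : IsMatrixIrrep w D')
    (hne : ¬ IsIsomorphic D' D) (i j : Fin d) (k l : Fin d') :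
    ∑ g, D g i j * star (D' g k l) = 0 := by
  have h := hD.intertwiner_eq_zero hD' hne _
    (hD.sum_intertwines hD' (Matrix.single j l (1 : ℂ)))
  have h2 := congrFun (congrFun h i) k
  rw [Matrix.sum_apply] at h2
  simpa only [mul_single_mul_conjTranspose_apply, Matrix.zero_apply] using h2

open Matrix in
/-- Orthogonality relations for matrix elements of one irrep. -/
theorem IsMatrixIrrep.orthogonality [Fintype 𝒢] {d : ℕ}
    {D : 𝒢 → Matrix (Fin d) (Fin d) ℂ} (hD : IsMatrixIrrep w D) (i j k l : Fin d) :
    ∑ g, D g i j * star (D g k l) =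
      if i = k ∧ j = l then (Fintype.card 𝒢 : ℂ) / d else 0 := by
  obtain ⟨c, hc⟩ := hD.intertwiner_eq_smul_one _
    (hD.sum_intertwines hD (Matrix.single j l (1 : ℂ)))
  have hd : (d : ℂ) ≠ 0 := Nat.cast_ne_zero.2 hD.dim_pos.ne'
  have htr := congrArg Matrix.trace hc
  -- The scalar `c` is found by comparing traces: conjugation by a unitary preserves the trace of
  -- the matrix unit.
  have hterm : ∀ g, Matrix.trace (D g * Matrix.single j l (1 : ℂ) * (D g)ᴴ) =
      if j = l then 1 else 0 := by
    intro g
    have hu : (D g)ᴴ * D g = 1 := Matrix.mem_unitaryGroup_iff'.1 (hD.unitary g)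
    rw [Matrix.trace_mul_comm, ← Matrix.mul_assoc, hu, Matrix.one_mul]
    split_ifs with h
    · rw [h]; simp
    · simp [Matrix.trace_single_eq_of_ne _ _ _ h]
  rw [Matrix.trace_sum, Finset.sum_congr rfl fun g _ => hterm g] at htr
  have h2 := congrFun (congrFun hc i) k
  rw [Matrix.sum_apply] at h2
  simp only [mul_single_mul_conjTranspose_apply] at h2
  rw [h2]
  simp only [Finset.sum_const, Finset.card_univ, nsmul_eq_mul, Matrix.trace_smul,
    Matrix.trace_one, Fintype.card_fin, smul_eq_mul, Matrix.smul_apply, Matrix.one_apply] at htr ⊢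
  have hc' : c = (Fintype.card 𝒢 : ℂ) * (if j = l then 1 else 0) / d := by
    rw [htr, mul_div_cancel_right₀ _ hd]
  rw [hc']
  by_cases h1 : i = k <;> by_cases h2 : j = l <;> simp [h1, h2]

end Schur

/-! ### Closing polygons in the complex plane. -/

section Polygon

/-- Existence of a triangle with sides `t`, `a`, `s`: as the side `a` turns through half a circle,
the length of the third side varies continuously from |t - a| to t + a. -/
theorem exists_norm_sub_mul_eq {t a s : ℝ} (ht : 0 ≤ t) (ha : 0 ≤ a)
    (h1 : |t - a| ≤ s) (h2 : s ≤ t + a) :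
    ∃ z : ℂ, ‖z‖ = 1 ∧ ‖(t : ℂ) - a * z‖ = s := by
  have hcont : ContinuousOn (fun θ : ℝ => ‖(t : ℂ) - a * Complex.exp (θ * Complex.I)‖)
      (Set.Icc 0 Real.pi) := by fun_prop
  have hivt := intermediate_value_Icc Real.pi_pos.le hcont
  have e0 : ‖(t : ℂ) - a * Complex.exp ((0 : ℝ) * Complex.I)‖ = |t - a| := by
    simp only [Complex.ofReal_zero, zero_mul, Complex.exp_zero, mul_one]
    rw [← Complex.ofReal_sub, Complex.norm_real, Real.norm_eq_abs]
  have e1 : ‖(t : ℂ) - a * Complex.exp ((Real.pi : ℝ) * Complex.I)‖ = t + a := by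
    rw [Complex.exp_pi_mul_I, mul_neg_one, sub_neg_eq_add, ← Complex.ofReal_add,
      Complex.norm_real, Real.norm_eq_abs, abs_of_nonneg (add_nonneg ht ha)]
  have hs : s ∈ (fun θ : ℝ => ‖(t : ℂ) - a * Complex.exp (θ * Complex.I)‖) ''
      Set.Icc 0 Real.pi := hivt (by simp only [e0, e1]; exact ⟨h1, h2⟩)
  obtain ⟨θ, -, hθ⟩ := hs
  exact ⟨_, Complex.norm_exp_ofReal_mul_I θ, hθ⟩

/-- Sides satisfying the polygon inequalities together with a further side of length `t` form a
closed polygon. -/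
theorem exists_unit_sum_eq {ι : Type*} [DecidableEq ι] (a : ι → ℝ) (ha : ∀ j, 0 ≤ a j)
    (s : Finset ι) : ∀ t : ℝ, 0 ≤ t → t ≤ ∑ j ∈ s, a j →
    (∀ j ∈ s, 2 * a j ≤ t + ∑ i ∈ s, a i) →
    ∃ z : ι → ℂ, (∀ j, ‖z j‖ = 1) ∧ ∑ j ∈ s, (a j : ℂ) * z j = t := by
  induction s using Finset.induction_on with
  | empty =>
    intro t ht ht' _
    refine ⟨fun _ => 1, by simp, ?_⟩
    have : t = 0 := le_antisymm (by simpa using ht') ht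
    simp [this]
  | insert j s hj ih =>
    intro t ht ht' hle
    rw [Finset.sum_insert hj] at ht'
    simp only [Finset.sum_insert hj] at hle
    have hS : 0 ≤ ∑ i ∈ s, a i := Finset.sum_nonneg fun i _ => ha i
    have hj' := hle j (Finset.mem_insert_self j s)
    set S := ∑ i ∈ s, a i with hSdef
    -- Cut off the triangle with sides `t` and `a j`. The third side is taken as long as both the
    -- triangle and the remaining sides (total length `S`) allow, so that the remaining polygon
    -- inequalities persist.
    obtain ⟨z₀, hz₀, hz₀'⟩ := exists_norm_sub_mul_eq (s := min (t + a j) S) ht (ha j)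
      (by rw [le_min_iff, abs_le, abs_le]
          have := ha j
          constructor <;> constructor <;> linarith) (min_le_left _ _)
    obtain ⟨z, hz, hz'⟩ := ih (min (t + a j) S) (le_min (add_nonneg ht (ha j)) hS)
      (min_le_right _ _) (by
        intro i hi
        have h1 := hle i (Finset.mem_insert_of_mem hi)
        have h2 : a i ≤ S := Finset.single_le_sum (f := a) (fun i _ => ha i) hi
        rw [← sub_le_iff_le_add, le_min_iff]
        constructor <;> linarith)
    set y : ℂ := (t : ℂ) - a j * z₀ with hy
    -- The induction hypothesis closes the rest against a nonnegative real side; `c` rotates that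
    -- side onto `y`. If `y = 0`, any phase will do.
    obtain ⟨c, hc, hcy⟩ : ∃ c : ℂ, ‖c‖ = 1 ∧ c * (min (t + a j) S : ℝ) = y := by
      by_cases h0 : y = 0
      · exact ⟨1, by simp, by rw [← hz₀', h0]; simp⟩
      · have : (‖y‖ : ℂ) ≠ 0 := by simpa using h0
        refine ⟨y / ‖y‖, by simp [h0], ?_⟩
        rw [← hz₀', div_mul_cancel₀ _ this]
    refine ⟨fun i => if i = j then z₀ else c * z i, ?_, ?_⟩
    · intro i
      dsimp only
      split_ifs
      · exact hz₀
      · rw [norm_mul, hc, hz, one_mul]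
    · rw [Finset.sum_insert hj]
      have : ∑ x ∈ s, (a x : ℂ) * (if x = j then z₀ else c * z x) =
          c * ∑ x ∈ s, (a x : ℂ) * z x := by
        rw [Finset.mul_sum]
        refine Finset.sum_congr rfl fun x hx => ?_
        rw [if_neg (ne_of_mem_of_not_mem hx hj)]
        ring
      simp only [this, hz', hcy, if_true, hy]
      ring

end Polygon

/-! ### Unitaries with prescribed constant diagonal. -/

section Fourier

open Matrix in
/-- A unitary matrix with constant diagonal equal to the mean of given phases. -/
theorem exists_unitary_diag_eq_mean {d : ℕ} (z : Fin d → ℂ) (hz : ∀ j, ‖z j‖ = 1) :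
    ∃ W ∈ Matrix.unitaryGroup (Fin d) ℂ, ∀ k, W k k = (∑ j, z j) / d := by
  rcases Nat.eq_zero_or_pos d with rfl | hd
  · exact ⟨1, one_mem _, fun k => k.elim0⟩
  have hd0 : (d : ℂ) ≠ 0 := Nat.cast_ne_zero.2 hd.ne'
  set q : ℂ := Complex.exp (2 * Real.pi * Complex.I / d) with hq
  have hprim : IsPrimitiveRoot q d := Complex.isPrimitiveRoot_exp d hd.ne'
  have hq1 : ‖q‖ = 1 := hprim.norm'_eq_one hd.ne'
  have hqs : q * star q = 1 := by
    simp [Complex.mul_conj, Complex.normSq_eq_norm_sq, hq1]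
  have hq0 : q ≠ 0 := left_ne_zero_of_mul_eq_one hqs
  have hqinv : star q = q⁻¹ := eq_inv_of_mul_eq_one_right hqs
  -- The Fourier matrix: it is unitary and all its entries have modulus 1/√d, so each diagonal entry
  -- of `F * diagonal z * star F` weights all the `z j` equally.
  set F : Matrix (Fin d) (Fin d) ℂ := fun k j => q ^ ((k : ℕ) * j) / (√(d : ℝ) : ℝ) with hF
  have hsq : ((√(d : ℝ) : ℝ) : ℂ) * ((√(d : ℝ) : ℝ) : ℂ) = d := by
    rw [← Complex.ofReal_mul, Real.mul_self_sqrt (Nat.cast_nonneg d)]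
    simp
  have hFF : F * star F = 1 := by
    ext k l
    rw [Matrix.mul_apply]
    have hterm : ∀ j : Fin d, F k j * (star F) j l =
        (q ^ (k : ℕ) * (q⁻¹) ^ (l : ℕ)) ^ (j : ℕ) / d := by
      intro j
      rw [Matrix.star_apply, hF]
      simp only [star_div₀, star_pow, hqinv, Complex.star_def, Complex.conj_ofReal]
      rw [div_mul_div_comm, hsq, mul_pow, ← pow_mul, ← pow_mul]
    rw [Finset.sum_congr rfl fun j _ => hterm j, ← Finset.sum_div,
      Fin.sum_univ_eq_sum_range (fun j => (q ^ (k : ℕ) * (q⁻¹) ^ (l : ℕ)) ^ j)]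
    by_cases hkl : k = l
    · subst hkl
      rw [inv_pow, mul_inv_cancel₀ (pow_ne_zero _ hq0)]
      simp [hd0]
    · rw [Matrix.one_apply_ne hkl]
      have hne : q ^ (k : ℕ) * (q⁻¹) ^ (l : ℕ) ≠ 1 := by
        intro h
        rw [inv_pow, mul_inv_eq_one₀ (pow_ne_zero _ hq0)] at h
        exact hkl (Fin.ext (hprim.pow_inj k.2 l.2 h))
      have hpow : (q ^ (k : ℕ) * (q⁻¹) ^ (l : ℕ)) ^ d = 1 := by
        rw [mul_pow, pow_right_comm, pow_right_comm q⁻¹, inv_pow, hprim.pow_eq_one]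
        simp
      have := mul_neg_geom_sum (q ^ (k : ℕ) * (q⁻¹) ^ (l : ℕ)) d
      rw [hpow, sub_self] at this
      rw [(mul_eq_zero.1 this).resolve_left (sub_ne_zero.2 hne.symm), zero_div]
  have hFu : F ∈ Matrix.unitaryGroup (Fin d) ℂ := Matrix.mem_unitaryGroup_iff.2 hFF
  have hzu : Matrix.diagonal z ∈ Matrix.unitaryGroup (Fin d) ℂ := by
    rw [Matrix.mem_unitaryGroup_iff, Matrix.star_eq_conjTranspose, Matrix.diagonal_conjTranspose,
      Matrix.diagonal_mul_diagonal, ← Matrix.diagonal_one]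
    congr 1
    ext j
    simp [Complex.mul_conj, Complex.normSq_eq_norm_sq, hz]
  refine ⟨F * Matrix.diagonal z * star F, mul_mem (mul_mem hFu hzu) (Unitary.star_mem hFu), ?_⟩
  intro k
  rw [Matrix.mul_apply, Finset.sum_div]
  refine Finset.sum_congr rfl fun j _ => ?_
  rw [Matrix.mul_diagonal, Matrix.star_apply, hF]
  simp only [star_div₀, star_pow, hqinv, Complex.star_def, Complex.conj_ofReal]
  rw [mul_right_comm, div_mul_div_comm, hsq, inv_pow, mul_inv_cancel₀ (pow_ne_zero _ hq0)]
  ring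

end Fourier

/-! ### Rank-one operators. -/

section Operators

variable {H : Type*} [NormedAddCommGroup H] [InnerProductSpace ℂ H]

@[simp]
theorem ketbra_apply (x y z : H) : ketbra x y z = ⟪y, z⟫_ℂ • x := by
  simp [ketbra]

theorem ketbra_smul_left (c : ℂ) (x y : H) : ketbra (c • x) y = c • ketbra x y := by
  ext z; simp [smul_smul, mul_comm]

theorem ketbra_sum_sum {ι κ : Type*} (s : Finset ι) (t : Finset κ) (a : ι → ℂ) (b : κ → ℂ)
    (x : ι → H) (y : κ → H) :
    ketbra (∑ i ∈ s, a i • x i) (∑ j ∈ t, b j • y j) =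
      ∑ i ∈ s, ∑ j ∈ t, (a i * star (b j)) • ketbra (x i) (y j) := by
  ext z
  simp only [ketbra_apply, LinearMap.sum_apply, LinearMap.smul_apply, sum_inner, inner_smul_left,
    Finset.smul_sum, smul_smul, Finset.sum_mul]
  refine Finset.sum_congr rfl fun i _ => ?_
  rw [← Finset.sum_smul]
  congr 1
  refine Finset.sum_congr rfl fun j _ => ?_
  rw [Complex.star_def]
  ring

theorem conj_ketbra (V : H ≃ₗᵢ[ℂ] H) (x y : H) : conj V (ketbra x y) = ketbra (V x) (V y) := by
  ext z
  simp only [conj, LinearMap.comp_apply, ketbra_apply]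
  have : ⟪y, V.symm z⟫_ℂ = ⟪V y, z⟫_ℂ := by
    rw [← V.inner_map_map, V.apply_symm_apply]
  simpa using by rw [this]

theorem ketbra_comp_ketbra (x y z u : H) :
    ketbra x y ∘ₗ ketbra z u = ⟪y, z⟫_ℂ • ketbra x u := by
  ext v
  simp [smul_smul, mul_comm]

theorem isPositive_ketbra (x : H) : (ketbra x x).IsPositive := by
  rw [LinearMap.isPositive_iff]
  refine ⟨fun u v => ?_, fun u => ?_⟩
  · simp [inner_smul_left, inner_smul_right, mul_comm]
  · rw [ketbra_apply, inner_smul_left, mul_comm, Complex.mul_conj']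
    exact_mod_cast sq_nonneg ‖⟪x, u⟫_ℂ‖

end Operators

theorem cast_card_pos (𝒢 : Type*) [Group 𝒢] [Fintype 𝒢] : (0 : ℝ) < Fintype.card 𝒢 :=
  Nat.cast_pos.2 Fintype.card_pos

/-! ### Group averages in the Schmidt basis. -/

namespace SchmidtDecomposition

variable {𝒢 : Type*} [Group 𝒢] [Fintype 𝒢] {H : Type*} [NormedAddCommGroup H]
  [InnerProductSpace ℂ H] {w : 𝒢 → 𝒢 → ℂ} {U : 𝒢 → H ≃ₗᵢ[ℂ] H} {ψ : H}
  (D : SchmidtDecomposition w U ψ)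

/-- Labels of the basis vectors of the span of the ensemble. -/
abbrev Label : Type := Σ μ : Fin D.n, Fin (D.d μ) × Fin (D.r μ)

/-- The vectors `v_i^μ ⊗ u_k^μ`, `k < r_μ`. -/
def vec (p : D.Label) : H := D.basis ⟨p.1, p.2.1, Fin.castLE (D.r_le_m p.1) p.2.2⟩

theorem orthonormal_vec : Orthonormal ℂ D.vec := by
  refine D.basis.orthonormal.comp
    (fun p : D.Label => (⟨p.1, p.2.1, Fin.castLE (D.r_le_m p.1) p.2.2⟩ :
      Σ μ : Fin D.n, Fin (D.d μ) × Fin (D.m μ))) ?_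
  rintro ⟨μ, i, k⟩ ⟨ν, j, l⟩ h
  simp only [Sigma.mk.injEq] at h
  obtain ⟨rfl, h⟩ := h
  simp only [heq_eq_eq, Prod.mk.injEq] at h
  obtain ⟨rfl, h⟩ := h
  rw [Fin.castLE_inj] at h
  rw [h]

/-- The vector with the given coordinates. -/
def combo (X : ∀ μ, Matrix (Fin (D.d μ)) (Fin (D.r μ)) ℂ) : H :=
  ∑ p : D.Label, X p.1 p.2.1 p.2.2 • D.vec p

/-- The operator `∑_{μ,k} f_{μ,k} 1 ⊗ |u_k^μ⟩⟨u_k^μ|`. -/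
def diagOp (f : ∀ μ, Fin (D.r μ) → ℂ) : H →ₗ[ℂ] H :=
  ∑ p : D.Label, f p.1 p.2.2 • ketbra (D.vec p) (D.vec p)

/-- In coordinates the group acts by left multiplication, leaving the multiplicity index alone. -/
theorem map_combo (g : 𝒢) (X : ∀ μ, Matrix (Fin (D.d μ)) (Fin (D.r μ)) ℂ) :
    U g (D.combo X) = D.combo fun μ => D.irrep μ g * X μ := by
  simp only [combo, map_sum, map_smul, Fintype.sum_sigma, Fintype.sum_prod_type, vec,
    D.equivariant, Matrix.mul_apply, Finset.sum_smul, Finset.smul_sum, smul_smul]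
  refine Finset.sum_congr rfl fun μ _ => ?_
  calc _ = ∑ i, ∑ j, ∑ k, (X μ i k * D.irrep μ g j i) •
        D.basis ⟨μ, j, Fin.castLE (D.r_le_m μ) k⟩ :=
        Finset.sum_congr rfl fun i _ => Finset.sum_comm
    _ = ∑ j, ∑ i, ∑ k, (X μ i k * D.irrep μ g j i) •
        D.basis ⟨μ, j, Fin.castLE (D.r_le_m μ) k⟩ := Finset.sum_comm
    _ = _ := by
      refine Finset.sum_congr rfl fun j _ => ?_
      rw [Finset.sum_comm]
      simp only [mul_comm]

theorem inner_combo (X Y : ∀ μ, Matrix (Fin (D.d μ)) (Fin (D.r μ)) ℂ) :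
    ⟪D.combo Y, D.combo X⟫_ℂ = ∑ μ, ∑ k, ∑ i, X μ i k * star (Y μ i k) := by
  have h := D.orthonormal_vec.inner_sum (fun p : D.Label => Y p.1 p.2.1 p.2.2)
    (fun p : D.Label => X p.1 p.2.1 p.2.2) Finset.univ
  rw [combo, combo, h, Fintype.sum_sigma]
  refine Finset.sum_congr rfl fun μ _ => ?_
  rw [Fintype.sum_prod_type, Finset.sum_comm]
  simp [mul_comm]

theorem sum_coeff_of_ne (X Y : ∀ μ, Matrix (Fin (D.d μ)) (Fin (D.r μ)) ℂ) {μ ν : Fin D.n}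
    (h : μ ≠ ν) (i : Fin (D.d μ)) (k : Fin (D.r μ)) (j : Fin (D.d ν)) (l : Fin (D.r ν)) :
    ∑ g, (D.irrep μ g * X μ) i k * star ((D.irrep ν g * Y ν) j l) = 0 := by
  simp only [Matrix.mul_apply, star_sum, star_mul', Finset.sum_mul_sum]
  rw [Finset.sum_comm]
  refine Finset.sum_eq_zero fun p _ => ?_
  rw [Finset.sum_comm]
  refine Finset.sum_eq_zero fun q _ => ?_
  have := (D.irrep_isIrrep μ).orthogonality_of_not_isIsomorphic (D.irrep_isIrrep ν)
    (D.inequivalent ν μ h.symm) i p j q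
  calc _ = (X μ p k * star (Y ν q l)) * ∑ g, D.irrep μ g i p * star (D.irrep ν g j q) := by
        rw [Finset.mul_sum]
        exact Finset.sum_congr rfl fun g _ => by ring
    _ = 0 := by rw [this, mul_zero]

/-- Orthogonality leaves the identity on the irrep factor, tensored with the cross product of the
columns of `X μ` and `Y μ`. -/
theorem sum_coeff (X Y : ∀ μ, Matrix (Fin (D.d μ)) (Fin (D.r μ)) ℂ) (μ : Fin D.n)
    (i : Fin (D.d μ)) (k : Fin (D.r μ)) (j : Fin (D.d μ)) (l : Fin (D.r μ)) :
    ∑ g, (D.irrep μ g * X μ) i k * star ((D.irrep μ g * Y μ) j l) =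
      if i = j then (Fintype.card 𝒢 : ℂ) / D.d μ * ∑ p, X μ p k * star (Y μ p l) else 0 := by
  simp only [Matrix.mul_apply, star_sum, star_mul', Finset.sum_mul_sum]
  rw [Finset.sum_comm]
  have key : ∀ p q, ∑ g, D.irrep μ g i p * X μ p k * (star (D.irrep μ g j q) * star (Y μ q l)) =
      if i = j ∧ p = q then (Fintype.card 𝒢 : ℂ) / D.d μ * (X μ p k * star (Y μ q l)) else 0 := by
    intro p q
    calc _ = (X μ p k * star (Y μ q l)) * ∑ g, D.irrep μ g i p * star (D.irrep μ g j q) := by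
          rw [Finset.mul_sum]
          exact Finset.sum_congr rfl fun g _ => by ring
      _ = _ := by
        rw [(D.irrep_isIrrep μ).orthogonality]
        split_ifs <;> ring
  rw [Finset.sum_congr rfl fun p _ => Finset.sum_comm]
  simp only [key]
  by_cases h : i = j
  · simp [h, Finset.mul_sum]
  · simp [h]

/-- The group average of `|x⟩⟨y|`, for vectors whose reduced cross operator on the multiplicity
spaces is diagonal. -/
theorem sum_ketbra_combo (X Y : ∀ μ, Matrix (Fin (D.d μ)) (Fin (D.r μ)) ℂ)
    (f : ∀ μ, Fin (D.r μ) → ℂ)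
    (hf : ∀ μ k l, ∑ i, X μ i k * star (Y μ i l) = if k = l then f μ k else 0) :
    ∑ g, ketbra (U g (D.combo X)) (U g (D.combo Y)) =
      D.diagOp fun μ k => (Fintype.card 𝒢 : ℂ) / D.d μ * f μ k := by
  simp only [map_combo]
  simp only [combo, ketbra_sum_sum, diagOp]
  rw [Finset.sum_comm]
  refine Finset.sum_congr rfl fun p _ => ?_
  rw [Finset.sum_comm]
  simp only [← Finset.sum_smul]
  rw [Finset.sum_eq_single p]
  · rw [sum_coeff, if_pos rfl, hf, if_pos rfl]
  · rintro ⟨ν, j, l⟩ - hq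
    obtain ⟨μ, i, k⟩ := p
    by_cases h : μ = ν
    · subst h
      dsimp only
      rw [sum_coeff, hf]
      by_cases hi : i = j
      · have hk : k ≠ l := fun hk => hq (by rw [hi, hk])
        simp [hk]
      · simp [hi]
    · dsimp only
      rw [sum_coeff_of_ne _ _ _ h, zero_smul]
  · simp

/-- Coordinates of a vector which is diagonal in the Schmidt basis. -/
def diagCoord (c : ∀ μ, Fin (D.r μ) → ℂ) (μ : Fin D.n) :
    Matrix (Fin (D.d μ)) (Fin (D.r μ)) ℂ :=
  fun i k => if i = Fin.castLE (D.r_le_d μ) k then c μ k else 0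

theorem combo_diagCoord (c : ∀ μ, Fin (D.r μ) → ℂ) :
    D.combo (D.diagCoord c) = ∑ μ, ∑ k, c μ k • D.ξ μ k := by
  rw [combo, Fintype.sum_sigma]
  refine Finset.sum_congr rfl fun μ _ => ?_
  rw [Fintype.sum_prod_type, Finset.sum_comm]
  refine Finset.sum_congr rfl fun k _ => ?_
  rw [Finset.sum_eq_single (Fin.castLE (D.r_le_d μ) k)]
  · simp [diagCoord, vec, ξ]
  · intro i _ hi
    simp [diagCoord, hi]
  · simp

theorem sum_diagCoord (c c' : ∀ μ, Fin (D.r μ) → ℂ) (μ : Fin D.n) (k l : Fin (D.r μ)) :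
    ∑ i, D.diagCoord c μ i k * star (D.diagCoord c' μ i l) =
      if k = l then c μ k * star (c' μ k) else 0 := by
  simp only [diagCoord, ite_mul, zero_mul, Finset.sum_ite_eq', Finset.mem_univ,
    if_true, Fin.castLE_inj]
  by_cases h : k = l
  · subst h; simp
  · simp [h]

theorem diagOp_apply (f : ∀ μ, Fin (D.r μ) → ℂ) (x : H) :
    D.diagOp f x = ∑ p : D.Label, (f p.1 p.2.2 * ⟪D.vec p, x⟫_ℂ) • D.vec p := by
  simp [diagOp, LinearMap.sum_apply, smul_smul]

theorem diagOp_vec (f : ∀ μ, Fin (D.r μ) → ℂ) (p : D.Label) :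
    D.diagOp f (D.vec p) = f p.1 p.2.2 • D.vec p := by
  rw [diagOp_apply, Finset.sum_eq_single p]
  · simp [D.orthonormal_vec.1 p, inner_self_eq_norm_sq_to_K]
  · intro q _ hq
    rw [D.orthonormal_vec.2 hq, mul_zero, zero_smul]
  · simp

theorem inner_vec_diagOp (f : ∀ μ, Fin (D.r μ) → ℂ) (p : D.Label) (x : H) :
    ⟪D.vec p, D.diagOp f x⟫_ℂ = f p.1 p.2.2 * ⟪D.vec p, x⟫_ℂ := by
  rw [diagOp_apply]
  exact D.orthonormal_vec.inner_right_fintype _ p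

theorem diagOp_congr {f f' : ∀ μ, Fin (D.r μ) → ℂ} (h : ∀ μ k, f μ k = f' μ k) :
    D.diagOp f = D.diagOp f' := by
  rw [show f = f' from funext fun μ => funext fun k => h μ k]

theorem smul_diagOp (c : ℂ) (f : ∀ μ, Fin (D.r μ) → ℂ) :
    c • D.diagOp f = D.diagOp fun μ k => c * f μ k := by
  simp only [diagOp, Finset.smul_sum, smul_smul]

theorem d_pos (μ : Fin D.n) : (0 : ℝ) < D.d μ := Nat.cast_pos.2 (D.irrep_isIrrep μ).dim_pos

theorem β_pos (μ : Fin D.n) (k : Fin (D.r μ)) : 0 < D.β μ k :=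
  Real.sqrt_pos.2 (div_pos (D.α_pos μ k) (cast_card_pos 𝒢))

/-- The seed coordinates are `√d_μ β_k^μ`. -/
theorem seed_eq_combo :
    ψ = D.combo (D.diagCoord fun μ k => ((√(D.d μ : ℝ) * D.β μ k : ℝ) : ℂ)) := by
  rw [combo_diagCoord]
  conv_lhs => rw [D.seed_eq]
  refine Finset.sum_congr rfl fun μ _ => Finset.sum_congr rfl fun k _ => ?_
  rw [ξ, β, Real.sqrt_div' _ (cast_card_pos 𝒢).le, Real.sqrt_div' _ (cast_card_pos 𝒢).le]
  congr 2
  ring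

/-- The signs of the optimal seed. -/
def sgn (μ₁ μ : Fin D.n) : ℝ := if μ = μ₁ then 1 else -1

theorem sgn_sq (μ₁ μ : Fin D.n) : D.sgn μ₁ μ * D.sgn μ₁ μ = 1 := by
  unfold sgn; split_ifs <;> norm_num

theorem optimalSeed_eq_combo (μ₁ : Fin D.n) :
    D.optimalSeed μ₁ = D.combo (D.diagCoord fun μ _ =>
      ((D.sgn μ₁ μ * √(D.d μ : ℝ) / √(Fintype.card 𝒢 : ℝ) : ℝ) : ℂ)) := by
  rw [combo_diagCoord, optimalSeed, ← Finset.add_sum_erase _ _ (Finset.mem_univ μ₁), smul_sub,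
    sub_eq_add_neg, Finset.smul_sum, Finset.smul_sum, ← Finset.sum_neg_distrib]
  congr 1
  · refine Finset.sum_congr rfl fun k _ => ?_
    rw [smul_smul, sgn, if_pos rfl, ← Complex.ofReal_mul]
    congr 2
    ring
  · refine Finset.sum_congr rfl fun μ hμ => ?_
    rw [Finset.smul_sum, ← Finset.sum_neg_distrib]
    refine Finset.sum_congr rfl fun k _ => ?_
    rw [smul_smul, sgn, if_neg (Finset.ne_of_mem_erase hμ), ← Complex.ofReal_mul, ← neg_smul,
      ← Complex.ofReal_neg]
    congr 2
    ring

theorem ζ_eq_sum (μ₁ : Fin D.n) :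
    D.ζ μ₁ = ∑ μ, ∑ k, D.sgn μ₁ μ * (D.d μ * D.β μ k) := by
  rw [ζ, ← Finset.add_sum_erase _ _ (Finset.mem_univ μ₁), sub_eq_add_neg, ← Finset.sum_neg_distrib]
  congr 1
  · simp [sgn]
  · refine Finset.sum_congr rfl fun μ hμ => ?_
    rw [← Finset.sum_neg_distrib]
    simp [sgn, Finset.ne_of_mem_erase hμ]

theorem inner_seed_optimalSeed (μ₁ : Fin D.n) :
    ⟪ψ, D.optimalSeed μ₁⟫_ℂ = ((D.ζ μ₁ / √(Fintype.card 𝒢 : ℝ) : ℝ) : ℂ) := by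
  have h := D.inner_combo
    (D.diagCoord fun μ _ => ((D.sgn μ₁ μ * √(D.d μ : ℝ) / √(Fintype.card 𝒢 : ℝ) : ℝ) : ℂ))
    (D.diagCoord fun μ k => ((√(D.d μ : ℝ) * D.β μ k : ℝ) : ℂ))
  rw [← seed_eq_combo, ← optimalSeed_eq_combo] at h
  simp only [sum_diagCoord, if_true] at h
  rw [h, ζ_eq_sum, Finset.sum_div, Complex.ofReal_sum]
  refine Finset.sum_congr rfl fun μ _ => ?_
  rw [Finset.sum_div, Complex.ofReal_sum]
  refine Finset.sum_congr rfl fun k _ => ?_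
  rw [Complex.star_def, Complex.conj_ofReal, ← Complex.ofReal_mul]
  congr 1
  have : √(D.d μ : ℝ) * √(D.d μ : ℝ) = D.d μ := Real.mul_self_sqrt (D.d_pos μ).le
  rw [div_mul_eq_mul_div]
  congr 1
  linear_combination (D.sgn μ₁ μ * D.β μ k) * this

/-- The factor d_μ from the squared seed coordinates √d_μ β_k^μ cancels the 1/d_μ of the
orthogonality relations. -/
theorem ensembleOp_eq_diagOp :
    ensembleOp (orbit U ψ) = D.diagOp fun μ k => ((D.β μ k ^ 2 : ℝ) : ℂ) := by
  have hG : (Fintype.card 𝒢 : ℂ) ≠ 0 := Nat.cast_ne_zero.2 Fintype.card_ne_zero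
  have h := D.sum_ketbra_combo _ _ _
    (D.sum_diagCoord (fun μ k => ((√(D.d μ : ℝ) * D.β μ k : ℝ) : ℂ))
      (fun μ k => ((√(D.d μ : ℝ) * D.β μ k : ℝ) : ℂ)))
  rw [← seed_eq_combo] at h
  simp only [ensembleOp, orbit]
  rw [h, smul_diagOp]
  refine D.diagOp_congr fun μ k => ?_
  have hd : (D.d μ : ℂ) ≠ 0 := Nat.cast_ne_zero.2 (D.irrep_isIrrep μ).dim_pos.ne'
  have : √(D.d μ : ℝ) * √(D.d μ : ℝ) = D.d μ := Real.mul_self_sqrt (D.d_pos μ).le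
  rw [Complex.star_def, Complex.conj_ofReal, ← Complex.ofReal_mul, mul_mul_mul_comm, this]
  push_cast
  field_simp

/-- Only the squares of the seed coordinates enter, so the signs are invisible here; they matter
only for the overlap with `ψ`. -/
theorem sum_covariant_optimalSeed (μ₁ : Fin D.n) :
    ∑ g, covariant U (D.optimalSeed μ₁) g = D.diagOp fun _ _ => 1 := by
  have hG : (Fintype.card 𝒢 : ℂ) ≠ 0 := Nat.cast_ne_zero.2 Fintype.card_ne_zero
  simp only [covariant, conj_ketbra, optimalSeed_eq_combo]
  rw [D.sum_ketbra_combo _ _ _ (D.sum_diagCoord _ _)]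
  refine D.diagOp_congr fun μ k => ?_
  have hd : (D.d μ : ℂ) ≠ 0 := Nat.cast_ne_zero.2 (D.irrep_isIrrep μ).dim_pos.ne'
  rw [Complex.star_def, Complex.conj_ofReal, ← Complex.ofReal_mul, div_mul_div_comm,
    mul_mul_mul_comm, Real.mul_self_sqrt (D.d_pos μ).le, Real.mul_self_sqrt (cast_card_pos 𝒢).le,
    sgn_sq, one_mul]
  push_cast
  field_simp

theorem dualOp_eq_diagOp (μ₁ : Fin D.n) :
    dualOp U ψ (D.optimalSeed μ₁) = D.diagOp fun μ k =>
      ((D.ζ μ₁ / Fintype.card 𝒢 * (D.sgn μ₁ μ * D.β μ k) : ℝ) : ℂ) := by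
  have hG : (Fintype.card 𝒢 : ℂ) ≠ 0 := Nat.cast_ne_zero.2 Fintype.card_ne_zero
  have hs : ⟪D.optimalSeed μ₁, ψ⟫_ℂ = ((D.ζ μ₁ / √(Fintype.card 𝒢 : ℝ) : ℝ) : ℂ) := by
    rw [← inner_conj_symm, inner_seed_optimalSeed, Complex.conj_ofReal]
  have h := D.sum_ketbra_combo _ _ _
    (D.sum_diagCoord
      (fun μ _ => ((D.sgn μ₁ μ * √(D.d μ : ℝ) / √(Fintype.card 𝒢 : ℝ) : ℝ) : ℂ))
      (fun μ k => ((√(D.d μ : ℝ) * D.β μ k : ℝ) : ℂ)))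
  rw [← seed_eq_combo, ← optimalSeed_eq_combo] at h
  have hc : ∀ g, conj (U g) (⟪D.optimalSeed μ₁, ψ⟫_ℂ • ketbra (D.optimalSeed μ₁) ψ) =
      ⟪D.optimalSeed μ₁, ψ⟫_ℂ • ketbra (U g (D.optimalSeed μ₁)) (U g ψ) := by
    intro g
    rw [← ketbra_smul_left, conj_ketbra, map_smul, ketbra_smul_left]
  simp only [dualOp, ketbra_comp_ketbra, hc, ← Finset.smul_sum]
  rw [h, hs, smul_diagOp, smul_diagOp]
  refine D.diagOp_congr fun μ k => ?_
  have hd : (D.d μ : ℝ) ≠ 0 := (D.d_pos μ).ne'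
  have hG' : (Fintype.card 𝒢 : ℝ) ≠ 0 := (cast_card_pos 𝒢).ne'
  rw [Complex.star_def, Complex.conj_ofReal]
  rw [← Complex.ofReal_natCast, ← Complex.ofReal_natCast, ← Complex.ofReal_one,
    ← Complex.ofReal_mul, ← Complex.ofReal_div, ← Complex.ofReal_div, ← Complex.ofReal_mul,
    ← Complex.ofReal_mul, ← Complex.ofReal_mul, Complex.ofReal_inj]
  have e1 : √(D.d μ : ℝ) * √(D.d μ : ℝ) = D.d μ := Real.mul_self_sqrt (D.d_pos μ).le
  have e2 : √(Fintype.card 𝒢 : ℝ) * √(Fintype.card 𝒢 : ℝ) = Fintype.card 𝒢 :=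
    Real.mul_self_sqrt (cast_card_pos 𝒢).le
  have e3 : √(Fintype.card 𝒢 : ℝ) ≠ 0 := (Real.sqrt_pos.2 (cast_card_pos 𝒢)).ne'
  calc _ = (D.ζ μ₁ * (D.sgn μ₁ μ * D.β μ k)) * (√(D.d μ : ℝ) * √(D.d μ : ℝ) / D.d μ) *
        (Fintype.card 𝒢 / Fintype.card 𝒢) / (√(Fintype.card 𝒢 : ℝ) * √(Fintype.card 𝒢 : ℝ)) := by
        field_simp
    _ = _ := by
      rw [e1, e2, div_self hd, div_self hG']
      ring

end SchmidtDecomposition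

/-! ### Positivity and the dual bound. -/

section Positivity

variable {H : Type*} [NormedAddCommGroup H] [InnerProductSpace ℂ H]

theorem isPositive_conj {A : H →ₗ[ℂ] H} (hA : A.IsPositive) (V : H ≃ₗᵢ[ℂ] H) :
    (conj V A).IsPositive :=
  (LinearMap.isPositive_linearIsometryEquiv_conj_iff V).2 hA

theorem isPositive_covariant {𝒢 : Type*} [Group 𝒢] (U : 𝒢 → H ≃ₗᵢ[ℂ] H) (ω : H) (g : 𝒢) :
    (covariant U ω g).IsPositive :=
  isPositive_conj (isPositive_ketbra ω) (U g)

variable [FiniteDimensional ℂ H]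

/-- The trace of a product of positive operators is nonnegative. -/
theorem re_trace_comp_nonneg {A B : H →ₗ[ℂ] H} (hA : A.IsPositive) (hB : B.IsPositive) :
    0 ≤ (LinearMap.trace ℂ H (A ∘ₗ B)).re := by
  rw [LinearMap.trace_eq_sum_inner _ (hB.isSymmetric.eigenvectorBasis rfl), Complex.re_sum]
  refine Finset.sum_nonneg fun i _ => ?_
  rw [LinearMap.comp_apply, hB.isSymmetric.apply_eigenvectorBasis, map_smul, inner_smul_right]
  have h1 := hB.nonneg_eigenvalues rfl i
  have h2 := hA.re_inner_nonneg_right (hB.isSymmetric.eigenvectorBasis rfl i)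
  simp only [RCLike.re_to_complex] at h2
  simpa using mul_nonneg h1 h2

theorem trace_comp_ketbra (A : H →ₗ[ℂ] H) (x y : H) :
    LinearMap.trace ℂ H (A ∘ₗ ketbra x y) = ⟪y, A x⟫_ℂ := by
  have : A ∘ₗ ketbra x y = ketbra (A x) y := by ext z; simp
  rw [this, ketbra]
  exact InnerProductSpace.trace_rankOne _ _

/-- Dual bound: an operator dominated by all the weighted states bounds the error from below. -/
theorem re_trace_le_errorProb {ι : Type*} [Fintype ι] {φ : ι → H}
    {Q : ι → H →ₗ[ℂ] H} (hQ : IsMeasurement φ Q) {Y : H →ₗ[ℂ] H}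
    (hY : ∀ k, ((1 / (Fintype.card ι : ℂ)) • ketbra (φ k) (φ k) - Y).IsPositive)
    (hrange : ∀ x, Y x ∈ Submodule.span ℂ (Set.range φ)) :
    (LinearMap.trace ℂ H Y).re ≤ errorProb φ Q := by
  -- Completeness is only available on the ensemble, hence on its span; this is why the range of `Y`
  -- must lie there.
  have hfix : (∑ k, Q k) ∘ₗ Y = Y := by
    ext x
    have hle : Submodule.span ℂ (Set.range φ) ≤ LinearMap.eqLocus (∑ k, Q k) LinearMap.id := by
      rw [Submodule.span_le]
      rintro _ ⟨j, rfl⟩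
      exact hQ.complete j
    exact hle (hrange x)
  have hsum : 0 ≤ ∑ k, (LinearMap.trace ℂ H
      (Q k ∘ₗ ((1 / (Fintype.card ι : ℂ)) • ketbra (φ k) (φ k) - Y))).re :=
    Finset.sum_nonneg fun k _ => re_trace_comp_nonneg (hQ.pos k) (hY k)
  have hterm : ∀ k, (LinearMap.trace ℂ H
      (Q k ∘ₗ ((1 / (Fintype.card ι : ℂ)) • ketbra (φ k) (φ k) - Y))).re =
      1 / (Fintype.card ι : ℝ) * (⟪φ k, Q k (φ k)⟫_ℂ).re -
        (LinearMap.trace ℂ H (Q k ∘ₗ Y)).re := by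
    intro k
    rw [LinearMap.comp_sub, LinearMap.comp_smul, map_sub, map_smul, trace_comp_ketbra,
      Complex.sub_re, smul_eq_mul]
    have : (1 / (Fintype.card ι : ℂ)) = ((1 / (Fintype.card ι : ℝ) : ℝ) : ℂ) := by push_cast; rfl
    rw [this, Complex.re_ofReal_mul]
  have htr : ∑ k, (LinearMap.trace ℂ H (Q k ∘ₗ Y)).re = (LinearMap.trace ℂ H Y).re := by
    have hfix' : ∑ k, Q k ∘ₗ Y = Y := by
      ext x
      simpa [LinearMap.sum_apply] using LinearMap.congr_fun hfix x
    rw [← Complex.re_sum, ← map_sum, hfix']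
  rw [Finset.sum_congr rfl fun k _ => hterm k, Finset.sum_sub_distrib, ← Finset.mul_sum,
    htr] at hsum
  rw [errorProb]
  linarith

end Positivity

/-! ### Error probability of a covariant measurement. -/

section Perfect

variable {𝒢 : Type*} [Group 𝒢] [Fintype 𝒢] {H : Type*} [NormedAddCommGroup H]
  [InnerProductSpace ℂ H]

/-- By unitarity all outcomes contribute the same amount, so perfect exclusion only requires a seed
orthogonal to `ψ`. -/
theorem errorProb_covariant (U : 𝒢 → H ≃ₗᵢ[ℂ] H) (ψ ω : H) :
    errorProb (orbit U ψ) (covariant U ω) = ‖⟪ψ, ω⟫_ℂ‖ ^ 2 := by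
  have hterm : ∀ g, (⟪orbit U ψ g, covariant U ω g (orbit U ψ g)⟫_ℂ).re = ‖⟪ψ, ω⟫_ℂ‖ ^ 2 := by
    intro g
    rw [orbit, covariant, conj_ketbra, ketbra_apply, inner_smul_right, (U g).inner_map_map,
      (U g).inner_map_map, ← inner_conj_symm, mul_comm, Complex.mul_conj']
    norm_cast
  have hG : (Fintype.card 𝒢 : ℝ) ≠ 0 := (cast_card_pos 𝒢).ne'
  rw [errorProb, Finset.sum_congr rfl fun g _ => hterm g]
  simp [hG]

end Perfect

/-! ### Perfect exclusion from a closed polygon. -/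

namespace SchmidtDecomposition

variable {𝒢 : Type*} [Group 𝒢] [Fintype 𝒢] {H : Type*} [NormedAddCommGroup H]
  [InnerProductSpace ℂ H] {w : 𝒢 → 𝒢 → ℂ} {U : 𝒢 → H ≃ₗᵢ[ℂ] H} {ψ : H}
  (D : SchmidtDecomposition w U ψ)

theorem diagOp_one_combo (X : ∀ μ, Matrix (Fin (D.d μ)) (Fin (D.r μ)) ℂ) :
    D.diagOp (fun _ _ => 1) (D.combo X) = D.combo X := by
  simp [combo, diagOp_vec]

theorem inner_diagOp (f : ∀ μ, Fin (D.r μ) → ℂ) (x y : H) :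
    ⟪x, D.diagOp f y⟫_ℂ = ∑ p : D.Label, f p.1 p.2.2 * (⟪x, D.vec p⟫_ℂ * ⟪D.vec p, y⟫_ℂ) := by
  rw [diagOp_apply, inner_sum]
  exact Finset.sum_congr rfl fun p _ => by rw [inner_smul_right]; ring

theorem isSymmetric_diagOp (f : ∀ μ, Fin (D.r μ) → ℝ) :
    (D.diagOp fun μ k => (f μ k : ℂ)).IsSymmetric := by
  intro x y
  rw [← inner_conj_symm, inner_diagOp, inner_diagOp, map_sum]
  refine Finset.sum_congr rfl fun p _ => ?_
  simp only [map_mul, Complex.conj_ofReal, inner_conj_symm]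
  ring

theorem inner_diagOp_self (f : ∀ μ, Fin (D.r μ) → ℝ) (x : H) :
    ⟪x, D.diagOp (fun μ k => (f μ k : ℂ)) x⟫_ℂ =
      ((∑ p : D.Label, f p.1 p.2.2 * ‖⟪D.vec p, x⟫_ℂ‖ ^ 2 : ℝ) : ℂ) := by
  rw [inner_diagOp, Complex.ofReal_sum]
  refine Finset.sum_congr rfl fun p _ => ?_
  rw [← inner_conj_symm x, mul_comm ((starRingEnd ℂ) _), Complex.mul_conj']
  push_cast
  rfl

theorem isPositive_one_sub_diagOp_one : (1 - D.diagOp fun _ _ => 1).IsPositive := by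
  have hsym := D.isSymmetric_diagOp fun _ _ => 1
  simp only [Complex.ofReal_one] at hsym
  refine ⟨LinearMap.IsSymmetric.sub (fun _ _ => rfl) hsym, fun x => ?_⟩
  have h := D.inner_diagOp_self (fun _ _ => 1) x
  simp only [Complex.ofReal_one, one_mul] at h
  have hb := D.orthonormal_vec.sum_inner_products_le x (s := Finset.univ)
  rw [← inner_conj_symm, RCLike.conj_re, LinearMap.sub_apply, inner_sub_right, h,
    Module.End.one_apply, inner_self_eq_norm_sq_to_K]
  simp only [RCLike.re_to_complex, Complex.sub_re, Complex.ofReal_re]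
  rw [sub_nonneg]
  exact hb.trans_eq (by norm_cast)

theorem diagOp_one_orbit (g : 𝒢) : D.diagOp (fun _ _ => 1) (orbit U ψ g) = orbit U ψ g := by
  have h1 := D.diagOp_one_combo fun μ => D.irrep μ g *
    D.diagCoord (fun μ k => ((√(D.d μ : ℝ) * D.β μ k : ℝ) : ℂ)) μ
  rw [← map_combo, ← seed_eq_combo] at h1
  exact h1

/-- A seed whose orbit resolves the identity on the span of the ensemble gives a measurement. -/
theorem isMeasurement_covariant {ω : H}
    (h : ∑ g, covariant U ω g = D.diagOp fun _ _ => 1) :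
    IsMeasurement (orbit U ψ) (covariant U ω) where
  pos := isPositive_covariant U ω
  le_one := by rw [h]; exact D.isPositive_one_sub_diagOp_one
  complete j := by rw [h, D.diagOp_one_orbit]

/-- Sides of the polygon: for each irrep, `d_μ` sides of length `∑_k β_k^μ`. -/
theorem perfectExclusion_of_polygon
    (h : ∀ μ, 2 * ∑ k, D.β μ k ≤ ∑ ν, D.d ν * ∑ k, D.β ν k) :
    PerfectExclusion (orbit U ψ) := by
  classical
  set a : (Σ μ : Fin D.n, Fin (D.d μ)) → ℝ := fun p => ∑ k, D.β p.1 k with ha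
  have ha0 : ∀ p, 0 ≤ a p := fun p => Finset.sum_nonneg fun k _ => (D.β_pos _ k).le
  have hsum : ∑ p, a p = ∑ ν, D.d ν * ∑ k, D.β ν k := by
    rw [Fintype.sum_sigma]
    refine Finset.sum_congr rfl fun μ _ => ?_
    change ∑ j : Fin (D.d μ), (∑ k, D.β μ k) = _
    simp
  obtain ⟨z, hz, hz0⟩ := exists_unit_sum_eq a ha0 Finset.univ 0 le_rfl
    (Finset.sum_nonneg fun p _ => ha0 p) (fun p _ => by
      rw [zero_add, hsum]
      exact h p.1)
  choose W hW hWd using fun μ => exists_unitary_diag_eq_mean (fun j => z ⟨μ, j⟩) fun j => hz _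
  set c : Fin D.n → ℝ := fun μ => √(D.d μ : ℝ) / √(Fintype.card 𝒢 : ℝ) with hc
  -- Seed coordinates: the first `r μ` columns of the unitary `W μ`, scaled by √(d_μ/|𝒢|) so that
  -- the orbit sums to `diagOp 1`.
  set X : ∀ μ, Matrix (Fin (D.d μ)) (Fin (D.r μ)) ℂ :=
    fun μ i k => c μ * W μ i (Fin.castLE (D.r_le_d μ) k) with hX
  have hXX : ∀ μ k l, ∑ i, X μ i k * star (X μ i l) =
      if k = l then ((c μ * c μ : ℝ) : ℂ) else 0 := by
    intro μ k l
    have hu := congrFun (congrFun (Matrix.mem_unitaryGroup_iff'.1 (hW μ))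
      (Fin.castLE (D.r_le_d μ) l)) (Fin.castLE (D.r_le_d μ) k)
    rw [Matrix.mul_apply, Matrix.one_apply] at hu
    simp only [Matrix.star_apply, Fin.castLE_inj] at hu
    calc _ = ((c μ * c μ : ℝ) : ℂ) * ∑ i, star (W μ i (Fin.castLE (D.r_le_d μ) l)) *
          W μ i (Fin.castLE (D.r_le_d μ) k) := by
          rw [Finset.mul_sum]
          refine Finset.sum_congr rfl fun i _ => ?_
          simp only [hX, star_mul', Complex.star_def, Complex.conj_ofReal]
          push_cast
          ring
      _ = _ := by
        rw [hu]
        simp [eq_comm]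
  refine ⟨covariant U (D.combo X), D.isMeasurement_covariant ?_, ?_⟩
  · simp only [covariant, conj_ketbra]
    rw [D.sum_ketbra_combo X X _ hXX]
    refine D.diagOp_congr fun μ k => ?_
    have hd : (D.d μ : ℂ) ≠ 0 := Nat.cast_ne_zero.2 (D.irrep_isIrrep μ).dim_pos.ne'
    have hG : (Fintype.card 𝒢 : ℂ) ≠ 0 := Nat.cast_ne_zero.2 Fintype.card_ne_zero
    rw [hc]
    dsimp only
    rw [div_mul_div_comm, Real.mul_self_sqrt (D.d_pos μ).le,
      Real.mul_self_sqrt (cast_card_pos 𝒢).le]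
    push_cast
    field_simp
  · rw [errorProb_covariant]
    -- The seed `ψ` sees only the diagonal of `W μ`; each entry is the mean of d_μ phases, and the
    -- 1/d_μ cancels the product of the two factors √d_μ.
    have hin : ⟪ψ, D.combo X⟫_ℂ = (1 / √(Fintype.card 𝒢 : ℝ) : ℝ) * ∑ p, (a p : ℂ) * z p := by
      have h1 := D.inner_combo X
        (D.diagCoord fun μ k => ((√(D.d μ : ℝ) * D.β μ k : ℝ) : ℂ))
      rw [← seed_eq_combo] at h1
      rw [h1, Fintype.sum_sigma, Finset.mul_sum]
      refine Finset.sum_congr rfl fun μ _ => ?_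
      have hd : (D.d μ : ℂ) ≠ 0 := Nat.cast_ne_zero.2 (D.irrep_isIrrep μ).dim_pos.ne'
      change _ = _ * ∑ j, ((∑ k, D.β μ k : ℝ) : ℂ) * z ⟨μ, j⟩
      rw [← Finset.mul_sum, Complex.ofReal_sum, Finset.sum_mul, Finset.mul_sum]
      refine Finset.sum_congr rfl fun k _ => ?_
      rw [Finset.sum_eq_single (Fin.castLE (D.r_le_d μ) k)
        (fun i _ hi => by simp [diagCoord, hi]) (by simp)]
      have e1 : ((√(D.d μ : ℝ) : ℝ) : ℂ) * ((√(D.d μ : ℝ) : ℝ) : ℂ) = D.d μ := by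
        rw [← Complex.ofReal_mul, Real.mul_self_sqrt (D.d_pos μ).le]
        simp
      simp only [hX, hc, hWd, diagCoord, if_true, Complex.star_def, Complex.conj_ofReal]
      push_cast
      calc _ = (((√(D.d μ : ℝ) : ℝ) : ℂ) * ((√(D.d μ : ℝ) : ℝ) : ℂ) / D.d μ) *
            (1 / ((√(Fintype.card 𝒢 : ℝ) : ℝ) : ℂ) * (D.β μ k * ∑ j, z ⟨μ, j⟩)) := by
            ring
        _ = _ := by rw [e1, div_self hd, one_mul]
    rw [hin, hz0]
    simp

/-- If perfect exclusion is impossible, one side of the polygon is longer than the sum of the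
others. -/
theorem exists_dominant (h : ¬ PerfectExclusion (orbit U ψ)) :
    ∃ μ₁, D.d μ₁ = 1 ∧ D.r μ₁ = 1 ∧ 0 < D.ζ μ₁ := by
  have h' := mt D.perfectExclusion_of_polygon h
  push Not at h'
  obtain ⟨μ₁, h1⟩ := h'
  have hs : ∀ μ, 0 ≤ ∑ k, D.β μ k := fun μ => Finset.sum_nonneg fun k _ => (D.β_pos μ k).le
  have hrest : 0 ≤ ∑ μ ∈ Finset.univ.erase μ₁, (D.d μ : ℝ) * ∑ k, D.β μ k :=
    Finset.sum_nonneg fun μ _ => mul_nonneg (D.d_pos μ).le (hs μ)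
  rw [← Finset.add_sum_erase _ _ (Finset.mem_univ μ₁)] at h1
  -- For d ≥ 2 the total already contains two copies of the dominant side.
  have hd : D.d μ₁ = 1 := by
    by_contra hne
    have h2 : 2 ≤ D.d μ₁ := by have := (D.irrep_isIrrep μ₁).dim_pos; omega
    have h3 : (2 : ℝ) ≤ D.d μ₁ := by exact_mod_cast h2
    have := mul_le_mul_of_nonneg_right h3 (hs μ₁)
    linarith
  -- Since r ≤ d = 1, the alternative is r = 0, where the dominant side would have length zero.
  have hr : D.r μ₁ = 1 := by
    by_contra hne
    have h0 : D.r μ₁ = 0 := by have := D.r_le_d μ₁; omega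
    have : IsEmpty (Fin (D.r μ₁)) := by rw [h0]; infer_instance
    rw [Finset.univ_eq_empty, Finset.sum_empty, mul_zero, mul_zero, zero_add] at h1
    linarith
  refine ⟨μ₁, hd, hr, ?_⟩
  rw [ζ]
  simp only [← Finset.mul_sum]
  rw [hd] at h1 ⊢
  simp only [Nat.cast_one, one_mul] at h1 ⊢
  linarith

end SchmidtDecomposition

/-! ### Invariance of the dual operator. -/

section Conj

variable {H : Type*} [NormedAddCommGroup H] [InnerProductSpace ℂ H]

theorem conj_sub (V : H ≃ₗᵢ[ℂ] H) (A B : H →ₗ[ℂ] H) : conj V (A - B) = conj V A - conj V B := by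
  ext x; simp [conj]

theorem conj_smul (V : H ≃ₗᵢ[ℂ] H) (c : ℂ) (A : H →ₗ[ℂ] H) : conj V (c • A) = c • conj V A := by
  ext x; simp [conj]

theorem conj_sum {ι : Type*} (s : Finset ι) (V : H ≃ₗᵢ[ℂ] H) (A : ι → H →ₗ[ℂ] H) :
    conj V (∑ i ∈ s, A i) = ∑ i ∈ s, conj V (A i) := by
  ext x; simp [conj, LinearMap.sum_apply]

/-- Group averages are invariant under conjugation by the representation. -/
theorem conj_dualOp {𝒢 : Type*} [Group 𝒢] [Fintype 𝒢] {w : 𝒢 → 𝒢 → ℂ} {U : 𝒢 → H ≃ₗᵢ[ℂ] H}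
    (hU : IsProjectiveRep w U) {ψ : H} (hψ : ‖ψ‖ = 1) (ω : H) (g : 𝒢) :
    conj (U g) (dualOp U ψ ω) = dualOp U ψ ω := by
  -- Comparing norms on the unit vector `ψ` shows that the multiplier is a phase, so it cancels
  -- between ket and bra.
  have hw : ∀ h, w g h * (starRingEnd ℂ) (w g h) = 1 := by
    intro h
    have h1 := congrArg norm (hU.map_mul g h ψ)
    rw [norm_smul, LinearIsometryEquiv.norm_map, LinearIsometryEquiv.norm_map,
      LinearIsometryEquiv.norm_map, hψ, mul_one] at h1
    rw [Complex.mul_conj', ← h1]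
    norm_num
  have key : ∀ h, conj (U g) (conj (U h) (ketbra ω ω ∘ₗ ketbra ψ ψ)) =
      conj (U (g * h)) (ketbra ω ω ∘ₗ ketbra ψ ψ) := by
    intro h
    rw [ketbra_comp_ketbra]
    simp only [conj_smul, conj_ketbra, hU.map_mul]
    congr 1
    ext z
    rw [ketbra_apply, ketbra_apply, inner_smul_left, smul_smul, mul_right_comm,
      mul_comm ((starRingEnd ℂ) _), hw, one_mul]
  rw [dualOp, conj_smul, conj_sum]
  congr 1
  simp only [key]
  exact Equiv.sum_comp (Equiv.mulLeft g)
    (fun h => conj (U h) (ketbra ω ω ∘ₗ ketbra ψ ψ))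

end Conj

/-- The scalar core of dual feasibility. Squaring `b * t ≤ P + E` leaves a cross term `2 * P * E`,
which AM–GM together with `E ^ 2 ≤ A * B` absorbs; with `b = ζ + A` the resulting bound factors as
`b * (P ^ 2 + ζ * B)`, and `b` cancels. -/
theorem weighted_square_le {ζ b A B E P t : ℝ} (hζ : 0 < ζ) (hA : 0 ≤ A) (hB : 0 ≤ B) (hP : 0 ≤ P)
    (hE0 : 0 ≤ E) (ht : 0 ≤ t) (hb : b = ζ + A) (hE : E ^ 2 ≤ A * B) (hbt : b * t ≤ P + E) :
    ζ * (b * t ^ 2) ≤ P ^ 2 + ζ * B := by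
  have hb0 : 0 < b := by linarith
  have h1 : 2 * (ζ * P * E) ≤ ζ ^ 2 * B + A * P ^ 2 := by
    refine (sq_le_sq₀ (by positivity) (by positivity)).1 ?_
    have h2 : (ζ * P) ^ 2 * E ^ 2 ≤ (ζ * P) ^ 2 * (A * B) :=
      mul_le_mul_of_nonneg_left hE (by positivity)
    have h3 := sq_nonneg (ζ ^ 2 * B - A * P ^ 2)
    nlinarith
  have h4 : (b * t) ^ 2 ≤ (P + E) ^ 2 := pow_le_pow_left₀ (by positivity) hbt 2
  have h5 : ζ * (b * t) ^ 2 ≤ ζ * (P + E) ^ 2 := mul_le_mul_of_nonneg_left h4 hζ.le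
  have h6 : ζ * E ^ 2 ≤ ζ * (A * B) := mul_le_mul_of_nonneg_left hE hζ.le
  refine le_of_mul_le_mul_left ?_ hb0
  calc b * (ζ * (b * t ^ 2)) = ζ * (b * t) ^ 2 := by ring
    _ ≤ ζ * (P + E) ^ 2 := h5
    _ = ζ * P ^ 2 + 2 * (ζ * P * E) + ζ * E ^ 2 := by ring
    _ ≤ ζ * P ^ 2 + (ζ ^ 2 * B + A * P ^ 2) + ζ * (A * B) := by linarith
    _ = b * (P ^ 2 + ζ * B) := by rw [hb]; ring

/-! ### The dominant irrep: spectrum, dual feasibility and optimality. -/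

namespace SchmidtDecomposition

variable {𝒢 : Type*} [Group 𝒢] [Fintype 𝒢] {H : Type*} [NormedAddCommGroup H]
  [InnerProductSpace ℂ H] {w : 𝒢 → 𝒢 → ℂ} {U : 𝒢 → H ≃ₗᵢ[ℂ] H} {ψ : H}
  (D : SchmidtDecomposition w U ψ)

/-- Each `vec p` is an eigenvector of Ω with nonzero eigenvalue, and Ω maps into the span of the
ensemble. -/
theorem vec_mem_span (p : D.Label) :
    D.vec p ∈ Submodule.span ℂ (Set.range (orbit U ψ)) := by
  have h1 : ensembleOp (orbit U ψ) (D.vec p) ∈ Submodule.span ℂ (Set.range (orbit U ψ)) := by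
    simp only [ensembleOp, LinearMap.smul_apply, LinearMap.sum_apply, ketbra_apply]
    exact Submodule.smul_mem _ _ (Submodule.sum_mem _ fun g _ =>
      Submodule.smul_mem _ _ (Submodule.subset_span ⟨g, rfl⟩))
  rw [ensembleOp_eq_diagOp, diagOp_vec] at h1
  exact (Submodule.smul_mem_iff _
    (Complex.ofReal_ne_zero.2 (pow_pos (D.β_pos p.1 p.2.2) 2).ne')).1 h1

theorem diagOp_mem_span (f : ∀ μ, Fin (D.r μ) → ℂ) (x : H) :
    D.diagOp f x ∈ Submodule.span ℂ (Set.range (orbit U ψ)) := by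
  rw [diagOp_apply]
  exact Submodule.sum_mem _ fun p _ => Submodule.smul_mem _ _ (D.vec_mem_span p)

theorem diagOp_one_eq_starProjection [FiniteDimensional ℂ H] :
    D.diagOp (fun _ _ => 1) =
      ((Submodule.span ℂ (Set.range (orbit U ψ))).starProjection : H →L[ℂ] H) := by
  ext x
  refine (Submodule.eq_starProjection_of_mem_of_inner_eq_zero (D.diagOp_mem_span _ x) ?_).symm
  intro y hy
  have hy' : D.diagOp (fun _ _ => 1) y = y := by
    have hle : Submodule.span ℂ (Set.range (orbit U ψ)) ≤
        LinearMap.eqLocus (D.diagOp fun _ _ => 1) LinearMap.id := by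
      rw [Submodule.span_le]
      rintro _ ⟨g, rfl⟩
      exact D.diagOp_one_orbit g
    exact hle hy
  have hs := D.isSymmetric_diagOp (fun _ _ => 1) x y
  simp only [Complex.ofReal_one] at hs
  rw [inner_sub_left, hs, hy', sub_self]

theorem trace_diagOp [FiniteDimensional ℂ H] (f : ∀ μ, Fin (D.r μ) → ℂ) :
    LinearMap.trace ℂ H (D.diagOp f) = ∑ μ, ∑ k, D.d μ * f μ k := by
  have h1 : ∀ p, LinearMap.trace ℂ H (ketbra (D.vec p) (D.vec p)) = 1 := by
    intro p
    rw [ketbra, InnerProductSpace.trace_rankOne, inner_self_eq_norm_sq_to_K,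
      D.orthonormal_vec.1 p]
    simp
  simp only [diagOp, map_sum, map_smul, h1, smul_eq_mul, mul_one]
  rw [Fintype.sum_sigma]
  refine Finset.sum_congr rfl fun μ _ => ?_
  rw [Fintype.sum_prod_type]
  change ∑ i : Fin (D.d μ), ∑ k, f μ k = _
  rw [← Finset.mul_sum]
  simp

theorem trace_dualOp [FiniteDimensional ℂ H] (μ₁ : Fin D.n) :
    (LinearMap.trace ℂ H (dualOp U ψ (D.optimalSeed μ₁))).re =
      D.ζ μ₁ ^ 2 / (Fintype.card 𝒢 : ℝ) := by
  rw [dualOp_eq_diagOp, trace_diagOp]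
  have : ∑ μ, ∑ k, (D.d μ : ℂ) *
      ((D.ζ μ₁ / Fintype.card 𝒢 * (D.sgn μ₁ μ * D.β μ k) : ℝ) : ℂ) =
      ((D.ζ μ₁ / Fintype.card 𝒢 * D.ζ μ₁ : ℝ) : ℂ) := by
    rw [show D.ζ μ₁ / Fintype.card 𝒢 * D.ζ μ₁ =
      D.ζ μ₁ / Fintype.card 𝒢 * ∑ μ, ∑ k, D.sgn μ₁ μ * (D.d μ * D.β μ k) by
        rw [← D.ζ_eq_sum μ₁], Finset.mul_sum, Complex.ofReal_sum]
    refine Finset.sum_congr rfl fun μ _ => ?_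
    rw [Finset.mul_sum, Complex.ofReal_sum]
    refine Finset.sum_congr rfl fun k _ => ?_
    push_cast
    ring
  rw [this, Complex.ofReal_re]
  ring

section Dominant

variable {D} {μ₁ : Fin D.n}

/-- `ζ > 0` says that the single dominant coefficient exceeds the sum of all the others weighted by
their dimensions d_ν ≥ 1. -/
theorem β_lt_of_dominant (hd : D.d μ₁ = 1) (hr : D.r μ₁ = 1) (hζ : 0 < D.ζ μ₁) {μ : Fin D.n}
    (hμ : μ ≠ μ₁) (k : Fin (D.r μ)) (k₁ : Fin (D.r μ₁)) : D.β μ k < D.β μ₁ k₁ := by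
  have : Subsingleton (Fin (D.r μ₁)) := by rw [hr]; infer_instance
  rw [ζ, Fintype.sum_subsingleton _ k₁, hd, Nat.cast_one, one_mul, sub_pos] at hζ
  refine lt_of_le_of_lt ?_ hζ
  have h0 : ∀ ν, ∀ l : Fin (D.r ν), 0 ≤ (D.d ν : ℝ) * D.β ν l :=
    fun ν l => mul_nonneg (D.d_pos ν).le (D.β_pos ν l).le
  calc D.β μ k = 1 * D.β μ k := (one_mul _).symm
    _ ≤ D.d μ * D.β μ k := by
      refine mul_le_mul_of_nonneg_right ?_ (D.β_pos μ k).le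
      exact_mod_cast (D.irrep_isIrrep μ).dim_pos
    _ ≤ ∑ l, (D.d μ : ℝ) * D.β μ l :=
      Finset.single_le_sum (f := fun l => (D.d μ : ℝ) * D.β μ l) (fun l _ => h0 μ l)
        (Finset.mem_univ k)
    _ ≤ _ := Finset.single_le_sum (f := fun ν => ∑ l, (D.d ν : ℝ) * D.β ν l)
        (fun ν _ => Finset.sum_nonneg fun l _ => h0 ν l)
        (Finset.mem_erase.2 ⟨hμ, Finset.mem_univ _⟩)

/-- If `x` were orthogonal to every `vec p`, then Ω x = 0 and κ = 0; a nonzero coordinate of `x`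
forces κ to equal the corresponding diagonal entry. -/
theorem exists_label_of_eigenvector {κ : ℝ} {x : H} (hx : x ≠ 0) (hκ : κ ≠ 0)
    (h : ensembleOp (orbit U ψ) x = (κ : ℂ) • x) :
    ∃ p : D.Label, ⟪D.vec p, x⟫_ℂ ≠ 0 ∧ κ = D.β p.1 p.2.2 ^ 2 := by
  by_contra! hcon
  rw [D.ensembleOp_eq_diagOp] at h
  have h0 : ∀ p, ⟪D.vec p, x⟫_ℂ = 0 := by
    intro p
    by_contra hp
    have h1 := congrArg (fun y => ⟪D.vec p, y⟫_ℂ) h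
    simp only [inner_vec_diagOp, inner_smul_right] at h1
    exact hcon p hp (Complex.ofReal_injective (mul_right_cancel₀ hp h1)).symm
  rw [diagOp_apply, Finset.sum_eq_zero fun p _ => by rw [h0, mul_zero, zero_smul]] at h
  exact (smul_ne_zero (Complex.ofReal_ne_zero.2 hκ) hx) h.symm

theorem hasLargestEigenvalue_iff (hd : D.d μ₁ = 1) (hr : D.r μ₁ = 1) (hζ : 0 < D.ζ μ₁)
    (μ : Fin D.n) : D.HasLargestEigenvalue μ ↔ μ = μ₁ := by
  have hsub : Subsingleton (Fin (D.r μ₁)) := by rw [hr]; infer_instance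
  set k₁ : Fin (D.r μ₁) := ⟨0, by omega⟩ with hk₁
  set p₁ : D.Label := ⟨μ₁, ⟨0, by omega⟩, k₁⟩ with hp₁
  have hβ := D.β_pos μ₁ k₁
  have hvec : ensembleOp (orbit U ψ) (D.vec p₁) = ((D.β μ₁ k₁ ^ 2 : ℝ) : ℂ) • D.vec p₁ := by
    rw [D.ensembleOp_eq_diagOp, diagOp_vec]
  have hvec0 : D.vec p₁ ≠ 0 := D.orthonormal_vec.ne_zero p₁
  constructor
  · rintro ⟨lam, hlam, x, hx, hx0, hxe⟩
    by_contra hμ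
    have h1 : D.β μ₁ k₁ ^ 2 ≤ lam :=
      hlam _ (Module.End.hasEigenvalue_of_hasEigenvector
        ⟨Module.End.mem_eigenspace_iff.2 hvec, hvec0⟩)
    have hpos : 0 < lam := lt_of_lt_of_le (pow_pos hβ 2) h1
    obtain ⟨p, hp, hlp⟩ := exists_label_of_eigenvector (D := D) hx0 hpos.ne' hxe
    -- Either the label lies in `μ`, and its eigenvalue is strictly below the dominant one, or `vec
    -- p` is orthogonal to the whole isotypic component containing `x`.
    by_cases hpμ : p.1 = μ
    · have := β_lt_of_dominant hd hr hζ (hpμ ▸ hμ : p.1 ≠ μ₁) p.2.2 k₁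
      have h2 := pow_lt_pow_left₀ this (D.β_pos _ _).le two_ne_zero
      linarith
    · apply hp
      rw [← Submodule.mem_orthogonal_singleton_iff_inner_right]
      refine (Submodule.span_le.2 ?_) hx
      rintro _ ⟨q, rfl⟩
      rw [SetLike.mem_coe, Submodule.mem_orthogonal_singleton_iff_inner_right]
      exact D.basis.orthonormal.2 fun h => hpμ (congrArg Sigma.fst h)
  · rintro rfl
    refine ⟨D.β μ k₁ ^ 2, ?_, D.vec p₁, Submodule.subset_span ⟨_, rfl⟩, hvec0, hvec⟩
    intro κ hκ
    obtain ⟨x, hx⟩ := hκ.exists_hasEigenvector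
    by_cases h0 : κ = 0
    · rw [h0]; positivity
    obtain ⟨p, -, hp⟩ := exists_label_of_eigenvector (D := D) hx.2 h0 hx.apply_eq_smul
    rw [hp]
    refine pow_le_pow_left₀ (D.β_pos _ _).le ?_ 2
    obtain ⟨ν, i, k⟩ := p
    by_cases hν : ν = μ
    · subst hν
      rw [Subsingleton.elim k k₁]
    · exact (β_lt_of_dominant hd hr hζ hν k k₁).le

theorem inner_seed (x : H) :
    ⟪ψ, x⟫_ℂ = ∑ μ, ∑ k, ((√(D.d μ : ℝ) * D.β μ k : ℝ) : ℂ) * ⟪D.ξ μ k, x⟫_ℂ := by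
  have h := D.seed_eq_combo
  rw [combo_diagCoord] at h
  conv_lhs => rw [h]
  simp only [sum_inner, inner_smul_left, Complex.conj_ofReal]

/-- The quadratic-form version of |𝒢| Y ≤ |ψ⟩⟨ψ|. The dominant coordinate of `x` is controlled by
⟨ψ, x⟩ and the other Schmidt coordinates, whose contribution is bounded by Cauchy–Schwarz. -/
theorem sum_sgn_le (hd : D.d μ₁ = 1) (hr : D.r μ₁ = 1) (hζ : 0 < D.ζ μ₁) (x : H) :
    D.ζ μ₁ * ∑ p : D.Label, D.sgn μ₁ p.1 * D.β p.1 p.2.2 * ‖⟪D.vec p, x⟫_ℂ‖ ^ 2 ≤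
      ‖⟪ψ, x⟫_ℂ‖ ^ 2 := by
  have hsubr : Subsingleton (Fin (D.r μ₁)) := by rw [hr]; infer_instance
  have hsubd : Subsingleton (Fin (D.d μ₁)) := by rw [hd]; infer_instance
  set k₁ : Fin (D.r μ₁) := ⟨0, by omega⟩ with hk₁
  set S : Finset (Σ μ : Fin D.n, Fin (D.r μ)) :=
    (Finset.univ.erase μ₁).sigma fun _ => Finset.univ with hS
  set t : (Σ μ : Fin D.n, Fin (D.r μ)) → ℝ := fun q => ‖⟪D.ξ q.1 q.2, x⟫_ℂ‖ with ht
  set A := ∑ q ∈ S, (D.d q.1 : ℝ) * D.β q.1 q.2 with hA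
  set B := ∑ q ∈ S, D.β q.1 q.2 * t q ^ 2 with hB
  set E := ∑ q ∈ S, √(D.d q.1 : ℝ) * D.β q.1 q.2 * t q with hE
  have hβ : ∀ q : (Σ μ : Fin D.n, Fin (D.r μ)), 0 ≤ D.β q.1 q.2 := fun q => (D.β_pos _ _).le
  have hbA : D.β μ₁ k₁ = D.ζ μ₁ + A := by
    rw [ζ, Fintype.sum_subsingleton _ k₁, hd, hA, hS, Finset.sum_sigma]
    simp
  have hEAB : E ^ 2 ≤ A * B := by
    -- Each term √d β t of `E` is split as √(d β) times √β t, which produces exactly `A` and `B`.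
    have h := Finset.sum_mul_sq_le_sq_mul_sq S
      (fun q => √((D.d q.1 : ℝ) * D.β q.1 q.2)) (fun q => √(D.β q.1 q.2) * t q)
    have e1 : ∑ q ∈ S, √((D.d q.1 : ℝ) * D.β q.1 q.2) * (√(D.β q.1 q.2) * t q) = E := by
      refine Finset.sum_congr rfl fun q _ => ?_
      rw [Real.sqrt_mul (Nat.cast_nonneg _), ← mul_assoc, mul_assoc (√(D.d q.1 : ℝ)),
        Real.mul_self_sqrt (hβ q)]
    have e2 : ∑ q ∈ S, √((D.d q.1 : ℝ) * D.β q.1 q.2) ^ 2 = A :=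
      Finset.sum_congr rfl fun q _ =>
        Real.sq_sqrt (mul_nonneg (Nat.cast_nonneg _) (hβ q))
    have e3 : ∑ q ∈ S, (√(D.β q.1 q.2) * t q) ^ 2 = B :=
      Finset.sum_congr rfl fun q _ => by rw [mul_pow, Real.sq_sqrt (hβ q)]
    rwa [e1, e2, e3] at h
  have hbt : D.β μ₁ k₁ * t ⟨μ₁, k₁⟩ ≤ ‖⟪ψ, x⟫_ℂ‖ + E := by
    have h := D.inner_seed x
    rw [← Finset.add_sum_erase _ _ (Finset.mem_univ μ₁), Fintype.sum_subsingleton _ k₁, hd,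
      Nat.cast_one, Real.sqrt_one, one_mul, ← Finset.sum_sigma (Finset.univ.erase μ₁)
      (fun _ => Finset.univ) fun q : (Σ μ : Fin D.n, Fin (D.r μ)) =>
        ((√(D.d q.1 : ℝ) * D.β q.1 q.2 : ℝ) : ℂ) * ⟪D.ξ q.1 q.2, x⟫_ℂ] at h
    have h1 := norm_le_norm_sub_add ((D.β μ₁ k₁ : ℂ) * ⟪D.ξ μ₁ k₁, x⟫_ℂ)
      (-∑ q ∈ S, ((√(D.d q.1 : ℝ) * D.β q.1 q.2 : ℝ) : ℂ) * ⟪D.ξ q.1 q.2, x⟫_ℂ)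
    rw [sub_neg_eq_add, ← h, norm_neg, norm_mul, Complex.norm_real, Real.norm_eq_abs,
      abs_of_pos (D.β_pos _ _)] at h1
    refine h1.trans (add_le_add le_rfl ((norm_sum_le _ _).trans (Finset.sum_le_sum fun q _ => ?_)))
    rw [norm_mul, Complex.norm_real, Real.norm_eq_abs,
      abs_of_nonneg (mul_nonneg (Real.sqrt_nonneg _) (hβ q))]
  have hmain := weighted_square_le hζ
    (Finset.sum_nonneg fun q _ => mul_nonneg (Nat.cast_nonneg _) (hβ q))
    (Finset.sum_nonneg fun q _ => mul_nonneg (hβ q) (sq_nonneg (t q)))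
    (norm_nonneg ⟪ψ, x⟫_ℂ)
    (Finset.sum_nonneg fun q _ => mul_nonneg (mul_nonneg (Real.sqrt_nonneg _) (hβ q))
      (norm_nonneg _))
    (norm_nonneg _) hbA hEAB hbt
  -- Outside `μ₁` all terms are nonpositive, so it suffices to keep the diagonal vectors `ξ` among
  -- the `vec p`.
  have hsum : ∑ p : D.Label, D.sgn μ₁ p.1 * D.β p.1 p.2.2 * ‖⟪D.vec p, x⟫_ℂ‖ ^ 2 ≤
      D.β μ₁ k₁ * t ⟨μ₁, k₁⟩ ^ 2 - B := by
    rw [Fintype.sum_sigma, ← Finset.add_sum_erase _ _ (Finset.mem_univ μ₁), sub_eq_add_neg]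
    refine add_le_add (le_of_eq ?_) ?_
    · rw [Fintype.sum_prod_type,
        Fintype.sum_subsingleton _ (Fin.castLE (D.r_le_d μ₁) k₁), Fintype.sum_subsingleton _ k₁]
      simp [sgn, vec, ξ, ht]
    · rw [hB, hS, Finset.sum_sigma, ← Finset.sum_neg_distrib]
      refine Finset.sum_le_sum fun μ hμ => ?_
      rw [Fintype.sum_prod_type, Finset.sum_comm, ← Finset.sum_neg_distrib]
      refine Finset.sum_le_sum fun k _ => ?_
      simp only [sgn, if_neg (Finset.ne_of_mem_erase hμ), neg_mul, one_mul,
        Finset.sum_neg_distrib, neg_le_neg_iff]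
      exact Finset.single_le_sum
        (f := fun i => D.β μ k * ‖⟪D.vec ⟨μ, i, k⟩, x⟫_ℂ‖ ^ 2)
        (fun i _ => mul_nonneg (D.β_pos μ k).le (sq_nonneg _))
        (Finset.mem_univ (Fin.castLE (D.r_le_d μ) k))
  have := mul_le_mul_of_nonneg_left hsum hζ.le
  linarith

theorem isPositive_ketbra_sub_dualOp (hd : D.d μ₁ = 1) (hr : D.r μ₁ = 1) (hζ : 0 < D.ζ μ₁) :
    (ketbra ψ ψ - (Fintype.card 𝒢 : ℂ) • dualOp U ψ (D.optimalSeed μ₁)).IsPositive := by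
  have hG : (Fintype.card 𝒢 : ℝ) ≠ 0 := (cast_card_pos 𝒢).ne'
  have hY : (Fintype.card 𝒢 : ℂ) • dualOp U ψ (D.optimalSeed μ₁) =
      D.diagOp fun μ k => ((D.ζ μ₁ * (D.sgn μ₁ μ * D.β μ k) : ℝ) : ℂ) := by
    rw [dualOp_eq_diagOp, smul_diagOp]
    refine D.diagOp_congr fun μ k => ?_
    rw [← Complex.ofReal_natCast, ← Complex.ofReal_mul]
    congr 1
    field_simp
  rw [hY]
  refine ⟨(isPositive_ketbra ψ).isSymmetric.sub (D.isSymmetric_diagOp _), fun x => ?_⟩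
  rw [← inner_conj_symm, RCLike.conj_re, LinearMap.sub_apply, inner_sub_right,
    inner_diagOp_self, ketbra_apply, inner_smul_right, ← inner_conj_symm x, Complex.mul_conj',
    ← Complex.ofReal_pow, ← Complex.ofReal_sub, RCLike.re_to_complex, Complex.ofReal_re,
    sub_nonneg]
  refine le_trans (le_of_eq ?_) (sum_sgn_le hd hr hζ x)
  rw [Finset.mul_sum]
  exact Finset.sum_congr rfl fun p _ => by ring

/-- Conjugation by `U g` carries |ψ⟩⟨ψ| to the projector of the orbit state and fixes the dual
operator. -/
theorem isPositive_ketbra_orbit_sub_dualOp (hU : IsProjectiveRep w U) (hψ : ‖ψ‖ = 1)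
    (hd : D.d μ₁ = 1) (hr : D.r μ₁ = 1) (hζ : 0 < D.ζ μ₁) (g : 𝒢) :
    ((1 / (Fintype.card 𝒢 : ℂ)) • ketbra (orbit U ψ g) (orbit U ψ g) -
      dualOp U ψ (D.optimalSeed μ₁)).IsPositive := by
  have hG : (Fintype.card 𝒢 : ℂ) ≠ 0 := Nat.cast_ne_zero.2 Fintype.card_ne_zero
  have h := isPositive_conj (isPositive_ketbra_sub_dualOp hd hr hζ) (U g)
  rw [conj_sub, conj_smul, conj_dualOp hU hψ, conj_ketbra] at h
  have h2 := h.smul_of_nonneg (c := ((1 / (Fintype.card 𝒢 : ℝ) : ℝ) : ℂ))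
    (Complex.zero_le_real.2 (by positivity))
  rw [smul_sub, smul_smul] at h2
  push_cast at h2
  rwa [one_div_mul_cancel hG, one_smul] at h2

theorem isMinimumError_optimalSeed [FiniteDimensional ℂ H] (hU : IsProjectiveRep w U)
    (hψ : ‖ψ‖ = 1) (hd : D.d μ₁ = 1) (hr : D.r μ₁ = 1) (hζ : 0 < D.ζ μ₁) :
    IsMinimumError (orbit U ψ) (covariant U (D.optimalSeed μ₁)) ∧
      errorProb (orbit U ψ) (covariant U (D.optimalSeed μ₁)) =
        (D.ζ μ₁) ^ 2 / (Fintype.card 𝒢 : ℝ) := by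
  have herr : errorProb (orbit U ψ) (covariant U (D.optimalSeed μ₁)) =
      (D.ζ μ₁) ^ 2 / (Fintype.card 𝒢 : ℝ) := by
    rw [errorProb_covariant, inner_seed_optimalSeed, Complex.norm_real, Real.norm_eq_abs, sq_abs,
      div_pow, Real.sq_sqrt (cast_card_pos 𝒢).le]
  refine ⟨⟨D.isMeasurement_covariant (D.sum_covariant_optimalSeed μ₁), fun Q hQ => ?_⟩, herr⟩
  rw [herr, ← trace_dualOp]
  refine re_trace_le_errorProb hQ (isPositive_ketbra_orbit_sub_dualOp hU hψ hd hr hζ) fun x => ?_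
  rw [dualOp_eq_diagOp]
  exact D.diagOp_mem_span _ x

end Dominant

end SchmidtDecomposition

/-! ### Families of vectors transforming according to a given irrep. -/

section Tuples

variable {𝒢 : Type*} {H : Type*} [NormedAddCommGroup H] [InnerProductSpace ℂ H]

/-- The vectors `x_i` transform like the basis vectors of the matrix representation `D`. -/
def IsTuple (U : 𝒢 → H ≃ₗᵢ[ℂ] H) {d : ℕ} (D : 𝒢 → Matrix (Fin d) (Fin d) ℂ)
    (x : Fin d → H) : Prop :=
  ∀ g i, U g (x i) = ∑ j, D g j i • x j

variable {U : 𝒢 → H ≃ₗᵢ[ℂ] H} {d d' : ℕ} {D : 𝒢 → Matrix (Fin d) (Fin d) ℂ}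
  {D' : 𝒢 → Matrix (Fin d') (Fin d') ℂ}

theorem IsTuple.linearCombination_mulVec {x : Fin d → H} (hx : IsTuple U D x) (g : 𝒢)
    (v : Fin d → ℂ) :
    Fintype.linearCombination ℂ x ((D g).mulVec v) = U g (Fintype.linearCombination ℂ x v) := by
  simp only [Fintype.linearCombination_apply, map_sum, map_smul, hx g, Matrix.mulVec, dotProduct,
    Finset.sum_smul, Finset.smul_sum, smul_smul]
  rw [Finset.sum_comm]
  simp only [mul_comm]

theorem isTuple_of_intertwiner (L : (Fin d → ℂ) →ₗ[ℂ] H)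
    (hL : ∀ g v, L ((D g).mulVec v) = U g (L v)) : IsTuple U D fun i => L (Pi.single i 1) := by
  intro g i
  dsimp only
  have h : (D g).mulVec (Pi.single i 1) = ∑ j, D g j i • Pi.single j (1 : ℂ) := by
    rw [Matrix.mulVec_single_one]
    funext k
    simp [Finset.sum_apply, Pi.single_apply]
  rw [← hL, h, map_sum]
  simp only [map_smul]

/-- Unitarity of `U g` makes the matrix of inner products of two tuples an intertwiner, to which
Schur's lemma applies. -/
theorem IsTuple.mul_inner {w : 𝒢 → 𝒢 → ℂ} [Group 𝒢] (hD : IsMatrixIrrep w D) {x : Fin d → H}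
    {y : Fin d' → H} (hx : IsTuple U D x) (hy : IsTuple U D' y) (g : 𝒢) :
    D g * (Matrix.of fun i j => ⟪x i, y j⟫_ℂ) = (Matrix.of fun i j => ⟪x i, y j⟫_ℂ) * D' g := by
  set A : Matrix (Fin d) (Fin d') ℂ := Matrix.of fun i j => ⟪x i, y j⟫_ℂ with hA
  have h1 : A = star (D g) * (A * D' g) := by
    ext i j
    rw [Matrix.mul_apply]
    calc A i j = ⟪U g (x i), U g (y j)⟫_ℂ := ((U g).inner_map_map _ _).symm
      _ = _ := by
        rw [hx, hy, sum_inner]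
        refine Finset.sum_congr rfl fun k _ => ?_
        rw [inner_smul_left, inner_sum, Matrix.star_apply, Matrix.mul_apply]
        congr 1
        refine Finset.sum_congr rfl fun l _ => ?_
        rw [inner_smul_right, mul_comm]
        rfl
  calc D g * A = D g * (star (D g) * (A * D' g)) := by rw [← h1]
    _ = A * D' g := by
      rw [← Matrix.mul_assoc, Matrix.mem_unitaryGroup_iff.1 (hD.unitary g), Matrix.one_mul]

variable {w : 𝒢 → 𝒢 → ℂ} [Group 𝒢]

theorem IsTuple.inner_eq_zero (hD : IsMatrixIrrep w D) (hD' : IsMatrixIrrep w D')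
    (hne : ¬ IsIsomorphic D' D) {x : Fin d → H}
    {y : Fin d' → H} (hx : IsTuple U D x) (hy : IsTuple U D' y) (i : Fin d) (j : Fin d') :
    ⟪x i, y j⟫_ℂ = 0 :=
  congrFun (congrFun (hD.intertwiner_eq_zero hD' hne _ (hx.mul_inner hD hy)) i) j

theorem IsTuple.inner_eq (hD : IsMatrixIrrep w D) {x y : Fin d → H}
    (hx : IsTuple U D x) (hy : IsTuple U D y) (i₀ i j : Fin d) :
    ⟪x i, y j⟫_ℂ = if i = j then ⟪x i₀, y i₀⟫_ℂ else 0 := by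
  obtain ⟨c, hc⟩ := hD.intertwiner_eq_smul_one _ (hx.mul_inner hD hy)
  have h : ∀ i j, ⟪x i, y j⟫_ℂ = if i = j then c else 0 := by
    intro i j
    simpa [Matrix.one_apply] using congrFun (congrFun hc i) j
  rw [h, h, if_pos rfl]

/-- The possible values of the component `i₀` of a tuple. -/
def tupleSpace (U : 𝒢 → H ≃ₗᵢ[ℂ] H) (D : 𝒢 → Matrix (Fin d) (Fin d) ℂ) (i₀ : Fin d) :
    Submodule ℂ H where
  carrier := {h | ∃ x, IsTuple U D x ∧ x i₀ = h}
  zero_mem' := ⟨0, fun g i => by simp, rfl⟩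
  add_mem' := by
    rintro _ _ ⟨x, hx, rfl⟩ ⟨y, hy, rfl⟩
    exact ⟨x + y, fun g i => by simp [hx g, hy g, Finset.sum_add_distrib], rfl⟩
  smul_mem' := by
    rintro c _ ⟨x, hx, rfl⟩
    refine ⟨c • x, fun g i => ?_, rfl⟩
    simp only [Pi.smul_apply, map_smul, hx g, Finset.smul_sum]
    exact Finset.sum_congr rfl fun j _ => smul_comm _ _ _

end Tuples

/-! ### Decomposition into irreps. -/

section Irreducible

variable {𝒢 : Type*} {H : Type*} [NormedAddCommGroup H] [InnerProductSpace ℂ H]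
  {w : 𝒢 → 𝒢 → ℂ} {U : 𝒢 → H ≃ₗᵢ[ℂ] H}

theorem exists_minimal_invariant [FiniteDimensional ℂ H] {K : Submodule ℂ H} (hK : K ≠ ⊥)
    (hinv : ∀ g, ∀ x ∈ K, U g x ∈ K) :
    ∃ W ≤ K, W ≠ ⊥ ∧ (∀ g, ∀ x ∈ W, U g x ∈ W) ∧
      ∀ W' ≤ W, (∀ g, ∀ x ∈ W', U g x ∈ W') → W' = ⊥ ∨ W' = W := by
  obtain ⟨W, ⟨h1, h2, h3⟩, hmin⟩ := (wellFounded_lt (α := Submodule ℂ H)).has_min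
    {W | W ≤ K ∧ W ≠ ⊥ ∧ ∀ g, ∀ x ∈ W, U g x ∈ W} ⟨K, le_rfl, hK, hinv⟩
  refine ⟨W, h1, h2, h3, fun W' hle hW' => ?_⟩
  by_contra! hcon
  exact hmin W' ⟨hle.trans h1, hcon.1, hW'⟩ (lt_of_le_of_ne hle hcon.2)

variable [Group 𝒢]

/-- A minimal invariant subspace carries a matrix irrep. -/
theorem exists_irrep_of_minimal [FiniteDimensional ℂ H] (hU : IsProjectiveRep w U)
    {W : Submodule ℂ H} (hW : W ≠ ⊥)
    (hinv : ∀ g, ∀ x ∈ W, U g x ∈ W)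
    (hmin : ∀ W' ≤ W, (∀ g, ∀ x ∈ W', U g x ∈ W') → W' = ⊥ ∨ W' = W) :
    ∃ (d : ℕ) (D : 𝒢 → Matrix (Fin d) (Fin d) ℂ) (x : Fin d → H),
      IsMatrixIrrep w D ∧ IsTuple U D x ∧ Orthonormal ℂ x ∧ ∀ i, x i ∈ W := by
  set e := stdOrthonormalBasis ℂ W with he
  set x : Fin (Module.finrank ℂ W) → H := fun i => (e i : H) with hx
  have hxo : Orthonormal ℂ x := e.orthonormal.comp_linearIsometry W.subtypeₗᵢ
  have hxW : ∀ i, x i ∈ W := fun i => (e i).2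
  have hexp : ∀ y ∈ W, ∑ j, ⟪x j, y⟫_ℂ • x j = y := by
    intro y hy
    have := congrArg W.subtype (e.sum_repr' ⟨y, hy⟩)
    simpa [map_sum] using this
  set D : 𝒢 → Matrix (Fin (Module.finrank ℂ W)) (Fin (Module.finrank ℂ W)) ℂ :=
    fun g => Matrix.of fun j i => ⟪x j, U g (x i)⟫_ℂ with hD
  have htup : IsTuple U D x := fun g i => (hexp _ (hinv g _ (hxW i))).symm
  refine ⟨_, D, x, ⟨?_, ?_, ?_, ?_, ?_⟩, htup, hxo, hxW⟩
  · rwa [Module.finrank_pos_iff, Submodule.nontrivial_iff_ne_bot]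
  · intro g
    rw [Matrix.mem_unitaryGroup_iff']
    ext i k
    have h1 : ⟪U g (x i), U g (x k)⟫_ℂ = (1 : Matrix _ _ ℂ) i k := by
      rw [(U g).inner_map_map, orthonormal_iff_ite.1 hxo, Matrix.one_apply]
    rw [← h1, Matrix.mul_apply, htup g i, sum_inner]
    refine Finset.sum_congr rfl fun j _ => ?_
    rw [inner_smul_left]
    rfl
  · ext i j
    simp only [hD, hU.map_one, Matrix.of_apply]
    rw [orthonormal_iff_ite.1 hxo, Matrix.one_apply]
  · intro g h
    ext i j
    have h1 := congrArg (fun y => ⟪x i, y⟫_ℂ) (hU.map_mul g h (x j))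
    simp only [inner_smul_right] at h1
    rw [htup h j, map_sum, inner_sum] at h1
    rw [Matrix.mul_apply, Matrix.smul_apply, smul_eq_mul]
    refine Eq.trans (Finset.sum_congr rfl fun k _ => ?_) h1
    rw [map_smul, inner_smul_right, mul_comm]
    rfl
  · intro S hS
    set L := Fintype.linearCombination ℂ x with hL
    have hLinj : Function.Injective L := hxo.linearIndependent.fintypeLinearCombination_injective
    have hrange : ∀ v, L v ∈ W := by
      intro v
      rw [hL, Fintype.linearCombination_apply]
      exact Submodule.sum_mem _ fun i _ => Submodule.smul_mem _ _ (hxW i)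
    rcases hmin (S.map L) (by rintro _ ⟨v, -, rfl⟩; exact hrange v) (by
        rintro g _ ⟨v, hv, rfl⟩
        rw [← htup.linearCombination_mulVec]
        exact ⟨_, hS g v hv, rfl⟩) with h | h
    · exact Or.inl (Submodule.map_injective_of_injective hLinj (by rw [h, Submodule.map_bot]))
    · right
      rw [eq_top_iff]
      intro v _
      obtain ⟨v', hv', hvv⟩ : L v ∈ S.map L := by rw [h]; exact hrange v
      exact hLinj hvv ▸ hv'

/-- The irreps occurring in `U`. -/
def Occurring (w : 𝒢 → 𝒢 → ℂ) (U : 𝒢 → H ≃ₗᵢ[ℂ] H) : Type _ :=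
  {p : Σ d, 𝒢 → Matrix (Fin d) (Fin d) ℂ //
    IsMatrixIrrep w p.2 ∧ ∃ x, IsTuple U p.2 x ∧ ∃ i, x i ≠ 0}

/-- Isomorphism of the irreps occurring in `U`. -/
def occurringSetoid (w : 𝒢 → 𝒢 → ℂ) (U : 𝒢 → H ≃ₗᵢ[ℂ] H) : Setoid (Occurring w U) where
  r p q := IsIsomorphic p.1.2 q.1.2
  iseqv := ⟨fun _ => IsIsomorphic.refl _, fun h => h.symm, fun h h' => h.trans h'⟩

theorem Occurring.not_isIsomorphic_out {p q : Quotient (occurringSetoid w U)} (h : p ≠ q) :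
    ¬ IsIsomorphic p.out.1.2 q.out.1.2 :=
  fun hiso => h (by rw [← p.out_eq, ← q.out_eq]; exact Quotient.sound hiso)

/-- Nonzero vectors taken from tuples of pairwise inequivalent irreps are orthogonal, hence
independent, so there are finitely many classes. -/
theorem Occurring.finite_quotient [FiniteDimensional ℂ H] :
    Finite (Quotient (occurringSetoid w U)) := by
  choose x hx i hi using fun q : Quotient (occurringSetoid w U) => q.out.2.2
  have hli : LinearIndependent ℂ fun q => x q (i q) :=
    linearIndependent_of_ne_zero_of_inner_eq_zero hi fun p q hpq =>
      (hx p).inner_eq_zero p.out.2.1 q.out.2.1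
        (Occurring.not_isIsomorphic_out hpq.symm) (hx q) _ _
  exact hli.finite_of_isNoetherian

/-- Decomposition of a projective representation into irreps. -/
theorem exists_isotypic_decomposition [FiniteDimensional ℂ H] (hU : IsProjectiveRep w U) :
    ∃ (n : ℕ) (d m : Fin n → ℕ) (D : ∀ μ, 𝒢 → Matrix (Fin (d μ)) (Fin (d μ)) ℂ)
      (b : OrthonormalBasis (Σ μ : Fin n, Fin (d μ) × Fin (m μ)) ℂ H),
      (∀ μ, IsMatrixIrrep w (D μ)) ∧ (∀ μ ν, μ ≠ ν → ¬ IsIsomorphic (D μ) (D ν)) ∧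
      ∀ g μ i a, U g (b ⟨μ, i, a⟩) = ∑ j, D μ g j i • b ⟨μ, j, a⟩ := by
  have hfin := Occurring.finite_quotient (w := w) (U := U)
  obtain ⟨n, ⟨e⟩⟩ := Finite.exists_equiv_fin (Quotient (occurringSetoid w U))
  set d : Fin n → ℕ := fun μ => (e.symm μ).out.1.1 with hd
  set D : ∀ μ, 𝒢 → Matrix (Fin (d μ)) (Fin (d μ)) ℂ := fun μ => (e.symm μ).out.1.2 with hDdef
  have hD : ∀ μ, IsMatrixIrrep w (D μ) := fun μ => (e.symm μ).out.2.1
  have hne : ∀ μ ν, μ ≠ ν → ¬ IsIsomorphic (D μ) (D ν) := fun μ ν h =>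
    Occurring.not_isIsomorphic_out fun h' => h (e.symm.injective h')
  set i₀ : ∀ μ, Fin (d μ) := fun μ => ⟨0, (hD μ).dim_pos⟩ with hi₀
  -- `N μ` serves as the multiplicity space: the intertwiners from `D μ` to `U`, realized in `H` by
  -- their component `i₀`. By `IsTuple.inner_eq`, orthonormality at `i₀` propagates to all
  -- components.
  set N : Fin n → Submodule ℂ H := fun μ => tupleSpace U (D μ) (i₀ μ) with hN
  set u := fun μ => stdOrthonormalBasis ℂ (N μ) with hu
  choose x hx hxu using fun μ a => (u μ a).2
  set v : (Σ μ : Fin n, Fin (d μ) × Fin (Module.finrank ℂ (N μ))) → H :=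
    fun p => x p.1 p.2.2 p.2.1 with hv
  have hvo : Orthonormal ℂ v := by
    rw [orthonormal_iff_ite]
    rintro ⟨μ, i, a⟩ ⟨ν, j, c⟩
    by_cases h : μ = ν
    · subst h
      have h1 : ⟪x μ a (i₀ μ), x μ c (i₀ μ)⟫_ℂ = if a = c then 1 else 0 := by
        rw [hxu, hxu, ← Submodule.coe_inner, orthonormal_iff_ite.1 (u μ).orthonormal]
      change ⟪x μ a i, x μ c j⟫_ℂ = _
      rw [(hx μ a).inner_eq (hD μ) (hx μ c) (i₀ μ), h1]
      by_cases hij : i = j <;> by_cases hac : a = c <;> simp [hij, hac]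
    · rw [if_neg fun h' => h (congrArg Sigma.fst h')]
      exact (hx μ a).inner_eq_zero (hD μ) (hD ν) (hne ν μ (Ne.symm h)) (hx ν c) i j
  have hspan : ⊤ ≤ Submodule.span ℂ (Set.range v) := by
    set K := Submodule.span ℂ (Set.range v) with hK
    have hKinv : ∀ g, ∀ y ∈ K, U g y ∈ K := by
      intro g y hy
      have hle : K ≤ K.comap (U g).toLinearEquiv.toLinearMap := by
        rw [hK, Submodule.span_le]
        rintro _ ⟨⟨μ, i, a⟩, rfl⟩
        change U g (x μ a i) ∈ K
        rw [hx μ a g i]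
        exact Submodule.sum_mem _ fun j _ => Submodule.smul_mem _ _
          (Submodule.subset_span ⟨⟨μ, j, a⟩, rfl⟩)
      exact hle hy
    by_contra hcon
    have hperp : Kᗮ ≠ ⊥ := fun h =>
      hcon (le_of_eq ((Submodule.orthogonal_eq_bot_iff).1 h).symm)
    have hperpinv : ∀ g, ∀ y ∈ Kᗮ, U g y ∈ Kᗮ := by
      intro g y hy k hk
      -- Applying `U g⁻¹` to both arguments moves the action onto `k ∈ K`, up to a multiplier.
      rw [← (U g⁻¹).inner_map_map, hU.map_mul, inv_mul_cancel, hU.map_one, inner_smul_right,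
        hy _ (hKinv _ _ hk), mul_zero]
    obtain ⟨W, hWK, hW0, hWinv, hWmin⟩ := exists_minimal_invariant hperp hperpinv
    obtain ⟨d', D', y, hD', hy, hyo, hyW⟩ := exists_irrep_of_minimal hU hW0 hWinv hWmin
    let q : Occurring w U := ⟨⟨d', D'⟩, hD', y, hy, ⟨0, hD'.dim_pos⟩, hyo.ne_zero _⟩
    set μ := e (Quotient.mk (occurringSetoid w U) q) with hμ
    have hiso : IsIsomorphic (D μ) D' := by
      have : (occurringSetoid w U).r (e.symm μ).out q := by
        rw [hμ, e.symm_apply_apply]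
        exact Quotient.exact (Quotient.out_eq _)
      exact this
    obtain ⟨T, hT⟩ := hiso
    -- The tuple found in the orthogonal complement of `K` is transported to the chosen
    -- representative of its class. Its component `i₀` then lies in `N μ`, hence in `K`, as well as
    -- in the complement: a contradiction.
    set L := Fintype.linearCombination ℂ y ∘ₗ T.toLinearMap with hL
    have htup : IsTuple U (D μ) fun i => L (Pi.single i 1) := by
      refine isTuple_of_intertwiner L fun g z => ?_
      simp only [hL, LinearMap.comp_apply, LinearEquiv.coe_coe]
      rw [hT, hy.linearCombination_mulVec]
    have hmemW : L (Pi.single (i₀ μ) 1) ∈ W := by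
      rw [hL, LinearMap.comp_apply, Fintype.linearCombination_apply]
      exact Submodule.sum_mem _ fun i _ => Submodule.smul_mem _ _ (hyW i)
    have hmemK : L (Pi.single (i₀ μ) 1) ∈ K := by
      have hmem : L (Pi.single (i₀ μ) 1) ∈ N μ := ⟨_, htup, rfl⟩
      have hs := congrArg (N μ).subtype ((u μ).sum_repr' ⟨_, hmem⟩)
      simp only [map_sum, map_smul, Submodule.subtype_apply] at hs
      rw [← hs]
      refine Submodule.sum_mem _ fun a _ => Submodule.smul_mem _ _ ?_
      rw [← hxu]
      exact Submodule.subset_span ⟨⟨μ, i₀ μ, a⟩, rfl⟩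
    have hzero : L (Pi.single (i₀ μ) 1) = 0 :=
      inner_self_eq_zero.1 (hWK hmemW _ hmemK)
    have hinj : Function.Injective L :=
      hyo.linearIndependent.fintypeLinearCombination_injective.comp T.injective
    have h0 : (Pi.single (i₀ μ) 1 : Fin (d μ) → ℂ) = 0 := hinj (by rw [hzero, map_zero])
    simpa using congrFun h0 (i₀ μ)
  refine ⟨n, d, fun μ => Module.finrank ℂ (N μ), D, OrthonormalBasis.mk hvo hspan, hD, hne, ?_⟩
  intro g μ i a
  simp only [OrthonormalBasis.coe_mk]
  exact hx μ a g i

end Irreducible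

/-! ### Singular value decomposition. -/

section SingularValues

/-- Singular value decomposition of a complex matrix. -/
theorem exists_singular_value_decomposition {d m : ℕ} (C : Matrix (Fin d) (Fin m) ℂ) :
    ∃ V ∈ Matrix.unitaryGroup (Fin d) ℂ, ∃ W ∈ Matrix.unitaryGroup (Fin m) ℂ,
    ∃ (r : ℕ) (hd : r ≤ d) (hm : r ≤ m) (s : Fin r → ℝ), (∀ k, 0 < s k) ∧
      ∀ i a, C i a = ∑ k, (s k : ℂ) * (V i (Fin.castLE hd k) * W a (Fin.castLE hm k)) := by
  -- The transpose makes T e_i the i-th row of `C`.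
  set T : EuclideanSpace ℂ (Fin d) →ₗ[ℂ] EuclideanSpace ℂ (Fin m) :=
    Matrix.toEuclideanLin C.transpose with hT
  have hdim : Module.finrank ℂ (EuclideanSpace ℂ (Fin d)) = d := by simp
  have hdim' : Module.finrank ℂ (EuclideanSpace ℂ (Fin m)) = m := by simp
  have hpos := T.isPositive_adjoint_comp_self
  set v := hpos.isSymmetric.eigenvectorBasis hdim with hv
  set r := Module.finrank ℂ (LinearMap.range T) with hr
  have hrd : r ≤ d := by
    have := LinearMap.finrank_range_le T
    rwa [hdim] at this
  have hrm : r ≤ m := by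
    have := Submodule.finrank_le (LinearMap.range T)
    rwa [hdim'] at this
  have hinner : ∀ k l, ⟪T (v k), T (v l)⟫_ℂ =
      if k = l then ((T.singularValues l : ℝ) : ℂ) ^ 2 else 0 := by
    intro k l
    have h1 : (LinearMap.adjoint T ∘ₗ T) (v l) = ((T.singularValues l ^ 2 : ℝ) : ℂ) • v l := by
      rw [T.sq_singularValues_fin hdim l]
      exact hpos.isSymmetric.apply_eigenvectorBasis hdim l
    rw [← LinearMap.adjoint_inner_right, ← LinearMap.comp_apply, h1, inner_smul_right,
      orthonormal_iff_ite.1 v.orthonormal]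
    by_cases h : k = l <;> simp [h]
  have hspos : ∀ k : Fin r, 0 < T.singularValues k := fun k =>
    T.singularValues_pos_iff_lt_finrank_range.2 k.2
  have hker : ∀ k : Fin d, r ≤ k → T (v k) = 0 := by
    intro k hk
    have h1 := hinner k k
    rw [if_pos rfl, T.singularValues_eq_zero_iff_le_finrank_range.2 hk] at h1
    rw [← inner_self_eq_zero (𝕜 := ℂ), h1]
    simp
  set f : Fin m → EuclideanSpace ℂ (Fin m) := fun a =>
    if h : (a : ℕ) < r then
      ((T.singularValues a : ℝ) : ℂ)⁻¹ • T (v ⟨a, h.trans_le hrd⟩) else 0 with hf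
  have hfo : Orthonormal ℂ (Set.domRestrict {a : Fin m | (a : ℕ) < r} f) := by
    rw [orthonormal_iff_ite]
    rintro ⟨a, ha⟩ ⟨c, hc⟩
    simp only [Set.mem_ofPred_eq] at ha hc
    have hsa : ((T.singularValues a : ℝ) : ℂ) ≠ 0 := Complex.ofReal_ne_zero.2 (hspos ⟨a, ha⟩).ne'
    simp only [Set.domRestrict_apply, hf, dif_pos ha, dif_pos hc, inner_smul_left, inner_smul_right,
      hinner, Subtype.mk.injEq, Fin.mk.injEq, Fin.val_inj]
    by_cases h : a = c
    · subst h
      simp only [if_true, map_inv₀, Complex.conj_ofReal]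
      field_simp
    · simp [h]
  obtain ⟨b, hb⟩ := hfo.exists_orthonormalBasis_extension_of_card_eq (by simp)
  -- The conjugate appears because the coordinate of e_i along `v k` is the conjugate of `v k i`.
  refine ⟨Matrix.of fun i k => star (v k i), ?_, Matrix.of fun a k => b k a, ?_, r, hrd, hrm,
    fun k => T.singularValues k, hspos, ?_⟩
  · rw [Matrix.mem_unitaryGroup_iff']
    ext k l
    have h1 := orthonormal_iff_ite.1 v.orthonormal l k
    rw [PiLp.inner_apply] at h1
    simp only [Matrix.mul_apply, Matrix.star_apply, Matrix.of_apply, star_star, Matrix.one_apply]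
    simp only [eq_comm (a := k)]
    rw [← h1]
    refine Finset.sum_congr rfl fun i _ => ?_
    simp
  · rw [Matrix.mem_unitaryGroup_iff']
    ext k l
    have h1 := orthonormal_iff_ite.1 b.orthonormal k l
    rw [PiLp.inner_apply] at h1
    simp only [Matrix.mul_apply, Matrix.star_apply, Matrix.of_apply, Matrix.one_apply]
    rw [← h1]
    refine Finset.sum_congr rfl fun i _ => ?_
    simp [mul_comm]
  · intro i a
    have h1 : C i a = T (EuclideanSpace.single i 1) a := by
      simp [hT, Matrix.toLpLin_apply]
    have h2 := v.sum_repr' (EuclideanSpace.single i (1 : ℂ))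
    rw [h1]
    conv_lhs => rw [← h2]
    simp only [map_sum, map_smul, EuclideanSpace.inner_single_right, one_mul]
    rw [← Fintype.sum_of_injective (Fin.castLE hrd) (Fin.castLE_injective hrd)
      (fun k => (starRingEnd ℂ) (v (Fin.castLE hrd k) i) • T (v (Fin.castLE hrd k)))
      (fun k => (starRingEnd ℂ) (v k i) • T (v k)) (by
        intro k hk
        have : r ≤ k := by
          by_contra hlt
          exact hk ⟨⟨k, not_le.1 hlt⟩, rfl⟩
        rw [hker k this, smul_zero]) (fun _ => rfl)]
    rw [WithLp.ofLp_sum, Finset.sum_apply]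
    refine Finset.sum_congr rfl fun k _ => ?_
    have hs : ((T.singularValues k : ℝ) : ℂ) ≠ 0 := Complex.ofReal_ne_zero.2 (hspos k).ne'
    have hbk : b (Fin.castLE hrm k) =
        ((T.singularValues k : ℝ) : ℂ)⁻¹ • T (v (Fin.castLE hrd k)) := by
      rw [hb _ (by simp), hf]
      simp only [Fin.val_castLE, k.2, dif_pos]
      rfl
    simp only [Matrix.of_apply, hbk, PiLp.smul_apply, smul_eq_mul]
    field_simp
    rw [mul_comm, Complex.star_def]

end SingularValues

/-! ### Existence of Schmidt decompositions. -/

section Existence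

theorem IsMatrixIrrep.unitary_conj {𝒢 : Type*} [Group 𝒢] {w : 𝒢 → 𝒢 → ℂ} {d : ℕ}
    {D : 𝒢 → Matrix (Fin d) (Fin d) ℂ}
    (hD : IsMatrixIrrep w D) {V : Matrix (Fin d) (Fin d) ℂ}
    (hV : V ∈ Matrix.unitaryGroup (Fin d) ℂ) :
    IsMatrixIrrep w fun g => star V * D g * V := by
  have h1 : star V * V = 1 := Matrix.mem_unitaryGroup_iff'.1 hV
  have h2 : V * star V = 1 := Matrix.mem_unitaryGroup_iff.1 hV
  refine ⟨hD.dim_pos, fun g => mul_mem (mul_mem (Unitary.star_mem hV) (hD.unitary g)) hV,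
    ?_, ?_, ?_⟩
  · rw [hD.map_one, Matrix.mul_one, h1]
  · intro g h
    calc star V * D g * V * (star V * D h * V) = star V * D g * (V * star V) * D h * V := by
          simp only [Matrix.mul_assoc]
      _ = star V * (D g * D h) * V := by rw [h2, Matrix.mul_one]; simp only [Matrix.mul_assoc]
      _ = _ := by rw [hD.map_mul, Matrix.mul_smul, Matrix.smul_mul]
  · intro S hS
    have hinj : Function.Injective V.mulVecLin := by
      refine Function.LeftInverse.injective (g := (star V).mulVecLin) fun x => ?_
      simp [Matrix.mulVec_mulVec, h1]
    rcases hD.irreducible (S.map V.mulVecLin) (by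
        rintro g _ ⟨x, hx, rfl⟩
        refine ⟨_, hS g x hx, ?_⟩
        simp only [Matrix.mulVecLin_apply, Matrix.mulVec_mulVec]
        rw [← Matrix.mul_assoc, ← Matrix.mul_assoc, h2, Matrix.one_mul]) with h | h
    · exact Or.inl (Submodule.map_injective_of_injective hinj (by rw [h, Submodule.map_bot]))
    · right
      rw [eq_top_iff]
      intro v _
      obtain ⟨v', hv', hvv⟩ : V.mulVecLin v ∈ S.map V.mulVecLin := h ▸ Submodule.mem_top
      exact hinj hvv ▸ hv'

theorem isIsomorphic_unitary_conj {𝒢 : Type*} {d : ℕ} (D : 𝒢 → Matrix (Fin d) (Fin d) ℂ)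
    {V : Matrix (Fin d) (Fin d) ℂ} (hV : V ∈ Matrix.unitaryGroup (Fin d) ℂ) :
    IsIsomorphic (fun g => star V * D g * V) D := by
  have h1 : star V * V = 1 := Matrix.mem_unitaryGroup_iff'.1 hV
  have h2 : V * star V = 1 := Matrix.mem_unitaryGroup_iff.1 hV
  refine ⟨LinearEquiv.ofLinearMap V.mulVecLin (star V).mulVecLin ?_ ?_, fun g x => ?_⟩
  · rw [← Matrix.mulVecLin_mul, h2, Matrix.mulVecLin_one]
  · rw [← Matrix.mulVecLin_mul, h1, Matrix.mulVecLin_one]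
  · simp only [LinearEquiv.coe_ofLinearMap, Matrix.mulVecLin_apply, Matrix.mulVec_mulVec]
    rw [← Matrix.mul_assoc, ← Matrix.mul_assoc, h2, Matrix.one_mul]

theorem nonempty_schmidtDecomposition {𝒢 : Type*} [Group 𝒢] [Fintype 𝒢] {H : Type*}
    [NormedAddCommGroup H] [InnerProductSpace ℂ H] [FiniteDimensional ℂ H] {w : 𝒢 → 𝒢 → ℂ}
    {U : 𝒢 → H ≃ₗᵢ[ℂ] H} (hU : IsProjectiveRep w U) (ψ : H) :
    Nonempty (SchmidtDecomposition w U ψ) := by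
  obtain ⟨n, d, m, D, b, hD, hne, heq⟩ := exists_isotypic_decomposition hU
  choose V hV W hW r hrd hrm s hs hC using fun μ : Fin n =>
    exists_singular_value_decomposition
      (Matrix.of fun (i : Fin (d μ)) (a : Fin (m μ)) => ⟪b ⟨μ, i, a⟩, ψ⟫_ℂ)
  -- The product basis after rotating the irrep factor by `V` and the multiplicity factor by `W`;
  -- only the former changes the irrep matrices, to `star V * D * V`.
  set c : (Σ μ : Fin n, Fin (d μ) × Fin (m μ)) → H := fun p =>
    ∑ i, ∑ a, (V p.1 i p.2.1 * W p.1 a p.2.2) • b ⟨p.1, i, a⟩ with hc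
  have hco : Orthonormal ℂ c := by
    rw [orthonormal_iff_ite]
    rintro ⟨μ, k, l⟩ ⟨ν, k', l'⟩
    by_cases h : μ = ν
    · subst h
      have hv := congrFun (congrFun (Matrix.mem_unitaryGroup_iff'.1 (hV μ)) k) k'
      have hw := congrFun (congrFun (Matrix.mem_unitaryGroup_iff'.1 (hW μ)) l) l'
      rw [Matrix.mul_apply, Matrix.one_apply] at hv hw
      have hpair : ∀ k l, c ⟨μ, k, l⟩ = ∑ p : Fin (d μ) × Fin (m μ),
          (V μ p.1 k * W μ p.2 l) • b ⟨μ, p⟩ := fun k l => by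
        rw [Fintype.sum_prod_type]
      have hbo : Orthonormal ℂ fun p : Fin (d μ) × Fin (m μ) => b ⟨μ, p⟩ :=
        b.orthonormal.comp _ sigma_mk_injective
      rw [hpair, hpair, hbo.inner_sum, Fintype.sum_prod_type]
      calc _ = (∑ i, star (V μ) k i * V μ i k') * ∑ a, star (W μ) l a * W μ a l' := by
            rw [Finset.sum_mul_sum]
            refine Finset.sum_congr rfl fun i _ => Finset.sum_congr rfl fun a _ => ?_
            simp only [map_mul, Matrix.star_apply, Complex.star_def]
            ring
        _ = _ := by
          rw [hv, hw]
          by_cases h1 : k = k' <;> by_cases h2 : l = l' <;> simp [h1, h2]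
    · rw [if_neg fun h' => h (congrArg Sigma.fst h')]
      have h0 : ∀ i a i' a', ⟪b ⟨μ, i, a⟩, b ⟨ν, i', a'⟩⟫_ℂ = 0 := fun i a i' a' =>
        b.orthonormal.2 fun h' => h (congrArg Sigma.fst h')
      simp [hc, sum_inner, inner_sum, inner_smul_left, inner_smul_right, h0]
  have hspan : ⊤ ≤ Submodule.span ℂ (Set.range c) :=
    (hco.linearIndependent.span_eq_top_of_card_eq_finrank'
      (Module.finrank_eq_card_basis b.toBasis).symm).ge
  have hG : (Fintype.card 𝒢 : ℝ) ≠ 0 := (cast_card_pos 𝒢).ne'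
  have hd0 : ∀ μ, (0 : ℝ) < d μ := fun μ => Nat.cast_pos.2 (hD μ).dim_pos
  refine ⟨{
    n := n, d := d, m := m
    irrep := fun μ g => star (V μ) * D μ g * V μ
    irrep_isIrrep := fun μ => (hD μ).unitary_conj (hV μ)
    inequivalent := fun μ ν h hiso => hne μ ν h
      (((isIsomorphic_unitary_conj (D μ) (hV μ)).symm.trans hiso).trans
        (isIsomorphic_unitary_conj (D ν) (hV ν)))
    basis := OrthonormalBasis.mk hco hspan
    equivariant := ?_
    r := r, r_le_d := hrd, r_le_m := hrm
    -- Chosen so that √(d_μ/|𝒢|) √α is the singular value `s μ k`.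
    α := fun μ k => s μ k ^ 2 * Fintype.card 𝒢 / d μ
    α_pos := fun μ k => div_pos (mul_pos (pow_pos (hs μ k) 2) (cast_card_pos 𝒢)) (hd0 μ)
    seed_eq := ?_ }⟩
  · intro g μ k l
    simp only [OrthonormalBasis.coe_mk, hc, map_sum, map_smul, heq, Finset.smul_sum, smul_smul]
    have hVD : ∀ j, ∑ k', (star (V μ) * D μ g * V μ) k' k * V μ j k' =
        ∑ i, V μ i k * D μ g j i := by
      intro j
      have h2 : V μ * star (V μ) = 1 := Matrix.mem_unitaryGroup_iff.1 (hV μ)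
      have h3 : V μ * (star (V μ) * D μ g * V μ) = D μ g * V μ := by
        rw [← Matrix.mul_assoc, ← Matrix.mul_assoc, h2, Matrix.one_mul]
      have h4 := congrFun (congrFun h3 j) k
      rw [Matrix.mul_apply, Matrix.mul_apply] at h4
      simpa only [mul_comm] using h4
    calc _ = ∑ j, ∑ a, (∑ i, V μ i k * D μ g j i) • W μ a l • b ⟨μ, j, a⟩ := by
          rw [Finset.sum_congr rfl fun i _ => Finset.sum_comm, Finset.sum_comm]
          refine Finset.sum_congr rfl fun j _ => ?_
          rw [Finset.sum_comm]
          refine Finset.sum_congr rfl fun a _ => ?_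
          rw [Finset.sum_smul]
          refine Finset.sum_congr rfl fun i _ => ?_
          rw [smul_smul]
          congr 1
          ring
      _ = _ := by
        simp only [← hVD]
        change _ = ∑ k' : Fin (d μ), ∑ j : Fin (d μ), ∑ a : Fin (m μ),
          ((star (V μ) * D μ g * V μ) k' k * (V μ j k' * W μ a l)) • b ⟨μ, j, a⟩
        refine Eq.trans ?_ Finset.sum_comm
        refine Finset.sum_congr rfl fun j _ => ?_
        refine Eq.trans ?_ Finset.sum_comm
        refine Finset.sum_congr rfl fun a _ => ?_
        rw [Finset.sum_smul]
        refine Finset.sum_congr rfl fun k' _ => ?_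
        rw [smul_smul, mul_assoc]
  · simp only [OrthonormalBasis.coe_mk, hc]
    conv_lhs => rw [← b.sum_repr' ψ]
    rw [Fintype.sum_sigma]
    refine Finset.sum_congr rfl fun μ _ => ?_
    have hcoef : ∀ k, √((d μ : ℝ) / Fintype.card 𝒢) * √(s μ k ^ 2 * Fintype.card 𝒢 / d μ) =
        s μ k := by
      intro k
      have hd1 := (hd0 μ).ne'
      rw [← Real.sqrt_mul (by positivity)]
      convert Real.sqrt_sq (hs μ k).le using 2
      field_simp
    have hC' : ∀ i a, ⟪b ⟨μ, i, a⟩, ψ⟫_ℂ = ∑ k, (s μ k : ℂ) *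
        (V μ i (Fin.castLE (hrd μ) k) * W μ a (Fin.castLE (hrm μ) k)) := hC μ
    simp only [hcoef, Fintype.sum_prod_type, hC', Finset.sum_smul, Finset.smul_sum, smul_smul]
    exact (Finset.sum_congr rfl fun i _ => Finset.sum_comm).trans Finset.sum_comm

end Existence

end

end QSE

theorem mainTheorem2 {𝒢 : Type*} [Group 𝒢] [Fintype 𝒢] {H : Type*} [NormedAddCommGroup H]
    [InnerProductSpace ℂ H] [FiniteDimensional ℂ H]
    (w : 𝒢 → 𝒢 → ℂ) (U : 𝒢 → H ≃ₗᵢ[ℂ] H) (hU : QSE.IsProjectiveRep w U)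
    (ψ : H) (hψ : ‖ψ‖ = 1)
    (hregion : ¬ QSE.PerfectExclusion (QSE.orbit U ψ)) :
    Nonempty (QSE.SchmidtDecomposition w U ψ) ∧
    ∀ D : QSE.SchmidtDecomposition w U ψ, ∃ μ₁ : Fin D.n,
      (∀ μ, D.HasLargestEigenvalue μ ↔ μ = μ₁) ∧ D.d μ₁ = 1 ∧ D.r μ₁ = 1 ∧
      0 < D.ζ μ₁ ∧
      inner ℂ ψ (D.optimalSeed μ₁) = ((D.ζ μ₁ / √(Fintype.card 𝒢 : ℝ) : ℝ) : ℂ) ∧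
      (∑ g, QSE.covariant U (D.optimalSeed μ₁) g : H →ₗ[ℂ] H) =
        ((Submodule.span ℂ (Set.range (QSE.orbit U ψ))).starProjection : H →L[ℂ] H) ∧
      (QSE.ketbra ψ ψ -
        (Fintype.card 𝒢 : ℂ) • QSE.dualOp U ψ (D.optimalSeed μ₁)).IsPositive ∧
      (∀ g, ((1 / (Fintype.card 𝒢 : ℂ)) • QSE.ketbra (QSE.orbit U ψ g) (QSE.orbit U ψ g) -
        QSE.dualOp U ψ (D.optimalSeed μ₁)).IsPositive) ∧
      QSE.IsMinimumError (QSE.orbit U ψ) (QSE.covariant U (D.optimalSeed μ₁)) ∧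
      QSE.errorProb (QSE.orbit U ψ) (QSE.covariant U (D.optimalSeed μ₁)) =
        (D.ζ μ₁) ^ 2 / (Fintype.card 𝒢 : ℝ) := by
  refine ⟨QSE.nonempty_schmidtDecomposition hU ψ, fun D => ?_⟩
  obtain ⟨μ₁, hd, hr, hζ⟩ := D.exists_dominant hregion
  exact ⟨μ₁, QSE.SchmidtDecomposition.hasLargestEigenvalue_iff hd hr hζ, hd, hr, hζ,
    D.inner_seed_optimalSeed μ₁,
    (D.sum_covariant_optimalSeed μ₁).trans D.diagOp_one_eq_starProjection,
    QSE.SchmidtDecomposition.isPositive_ketbra_sub_dualOp hd hr hζ,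
    QSE.SchmidtDecomposition.isPositive_ketbra_orbit_sub_dualOp hU hψ hd hr hζ,
    QSE.SchmidtDecomposition.isMinimumError_optimalSeed hU hψ hd hr hζ⟩
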